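/- **Setting.** Let $(M,g)$ be a smooth $2n$-dimensional manifold with a smooth non-degenerate metric of any signature, $\nabla$ its Levi-Civita connection (extended complex-linearly to $\mathbb C\otimes TM$), $U\subseteq M$ open, and $\{e_a\}_{a=1}^{2n}=\{e_1,\dots,e_n,\theta^1,\dots,\theta^n\}$ a smooth frame of $\mathbb C\otimes TM$ on $U$ with $g(e_i,\theta^j)=\tfrac12\delta_i^j$, $g(e_i,e_j)=g(\theta^i,\theta^j)=0$; put $g_{ab}=g(e_a,e_b)$. Spinor fields on $U$ are functions with values in $S=\wedge V^*$, $V^*=\mathrm{Span}\{\theta^i\}$, $V=\mathrm{Span}\{e_i\}$, with components in the basis $\hat\psi_\alpha\in\{\hat 1,\hat\theta^i,\hat\theta^{ij},\dots,\hat\theta^{1\cdots n}\}$ and Clifford action $(e+\theta)\cdot\hat\varphi=e\lrcorner\hat\varphi+\theta\wedge\hat\varphi$. With $\nabla_{e_a}e_b=\omega_{ab}{}^{c}e_c$ and a smooth complex $1$-form $A$ on $U$, the spinorial connection is $$\hat\nabla_a\hat\varphi=(\partial_a\varphi^\alpha)\hat\psi_\alpha+\Omega_a\cdot\hat\varphi,\qquad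 \Omega_a=-\tfrac14\,\omega_a{}^{bc}e_be_c+A_a .$$ The Dirac and twistor operators are $\hat D=g^{ab}e_a\cdot\hat\nabla_b$ and $\hat T_a=\hat\nabla_a-\frac1{2n}e_a\cdot\hat D$; $\hat\varphi$ is a *twistor* (with respect to $A$) if $\hat T_a\hat\varphi=0$ on $U$ for all $a$. A smooth spinor field $\hat\varphi$ is *pure* if at each point of $U$ it is nonzero and $N_{\hat\varphi}=\{v\in\mathbb C\otimes T_pM: v\cdot\hat\varphi=0\}$ has dimension $n$; $N_{\hat\varphi}$ is the maximally isotropic distribution generated by $\hat\varphi$. It is *integrable* if the Lie bracket of any two (local) smooth complex vector fields lying in it lies in it. **Theorem.** 1. $2n=4$. For all $(M,g)$, $U$, frames and smooth pure spinor fields $\hat\varphi$ as above: if $\hat\varphi$ is a twistor with respect to some $A$, then $N_{\hat\varphi}$ is integrable; conversely, if $N_{\hat\varphi}$ is integrable, then there is a smooth complex $1$-form $A$ on $U$ with respect to which $\hat\varphi$ is a twistor. 2. $2n=6$. Neither implication holds: for every signature $(r,s)$ with $r+s=6$ there are a metric of signature $(r,s)$ on $\mathbb R^6$, a frame, a $1$-form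 $A$ and a pure spinor field $\hat\varphi$ on $\mathbb R^6$ that is a twistor with respect to $A$ with $N_{\hat\varphi}$ not integrable; and there are such a metric, frame and pure spinor field $\hat\varphi$ on $\mathbb R^6$ with $N_{\hat\varphi}$ integrable for which $\hat\varphi$ is not a twistor with respect to any smooth complex $1$-form $A$. 3. $2n\ge 8$. For all $(M,g)$, $U$, frames, $A$ and smooth pure spinor fields $\hat\varphi$: if $\hat\varphi$ is a twistor with respect to $A$, then $N_{\hat\varphi}$ is integrable. The converse fails: for every $n\ge4$ and every signature $(r,s)$ with $r+s=2n$ there are a metric of signature $(r,s)$ on $\mathbb R^{2n}$, a frame and a pure spinor field $\hat\varphi$ on $\mathbb R^{2n}$ with $N_{\hat\varphi}$ integrable for which $\hat\varphi$ is not a twistor with respect to any smooth complex $1$-form $A$. -/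

import Mathlib

open scoped Manifold ContDiff

noncomputable section

namespace PureTwistor

/-! ### Spinors of `V ⊕ V*`, with `V = ℂⁿ` -/

/-- Indices of a frame `e_1, …, e_n, θ^1, …, θ^n` : `Sum.inl i` stands for `e_i` and `Sum.inr i`
for `θ^i`. -/
abbrev Idx (n : ℕ) := Fin n ⊕ Fin n

/-- The spinor space `S = ⋀ V*`, of dimension `2 ^ n`. The spinor `φ` stands for the form
`∑ s, φ s • θ^s`, where `θ^s = θ^{i₁} ∧ ⋯ ∧ θ^{iₖ}` for `s = {i₁ < ⋯ < iₖ}`. -/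
abbrev Spinor (n : ℕ) := Finset (Fin n) → ℂ

variable {n : ℕ}

/-- The sign `(-1) ^ #{j ∈ s | j < i}` that comes from moving `θ^i` to its place in `θ^s`. -/
def wedgeSign (i : Fin n) (s : Finset (Fin n)) : ℂ := (-1) ^ (s.filter (fun j => j < i)).card

/-- The exterior product `φ ↦ θ^i ∧ φ`. -/
def wedge (i : Fin n) : Spinor n →ₗ[ℂ] Spinor n where
  toFun φ s := if i ∈ s then wedgeSign i s * φ (s.erase i) else 0
  map_add' φ ψ := by
    funext s
    by_cases h : i ∈ s <;> simp [h, mul_add]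
  map_smul' c φ := by
    funext s
    by_cases h : i ∈ s <;> simp [h, mul_left_comm]

/-- The interior product `φ ↦ e_i ⌟ φ`. -/
def contract (i : Fin n) : Spinor n →ₗ[ℂ] Spinor n where
  toFun φ s := if i ∈ s then 0 else wedgeSign i s * φ (insert i s)
  map_add' φ ψ := by
    funext s
    by_cases h : i ∈ s <;> simp [h, mul_add]
  map_smul' c φ := by
    funext s
    by_cases h : i ∈ s <;> simp [h, mul_left_comm]

/-- The Clifford action of the frame vectors on spinors: `(e + θ) · φ = e ⌟ φ + θ ∧ φ`. -/
def gam : Idx n → (Spinor n →ₗ[ℂ] Spinor n) := Sum.elim contract wedge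

/-- The inner product of the frame vectors: `⟨e_i, θ^j⟩ = δ_ij / 2`, `⟨e_i, e_j⟩ = 0 = ⟨θ^i, θ^j⟩`. -/
def eta : Matrix (Idx n) (Idx n) ℂ :=
  Matrix.fromBlocks 0 ((1 / 2 : ℂ) • (1 : Matrix (Fin n) (Fin n) ℂ))
    ((1 / 2 : ℂ) • (1 : Matrix (Fin n) (Fin n) ℂ)) 0

/-- The inverse `g^{ab}` of the matrix `eta`. -/
def etaInv : Matrix (Idx n) (Idx n) ℂ :=
  Matrix.fromBlocks 0 ((2 : ℂ) • (1 : Matrix (Fin n) (Fin n) ℂ))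
    ((2 : ℂ) • (1 : Matrix (Fin n) (Fin n) ℂ)) 0

theorem eta_mul_etaInv : (eta : Matrix (Idx n) (Idx n) ℂ) * etaInv = 1 := by
  simp [eta, etaInv, Matrix.fromBlocks_multiply, smul_smul]

/-- `N_φ = {v ∈ V ⊕ V* | v · φ = 0}`, in components `v = ∑ a, v a • e_a`. -/
def annihilator (φ : Spinor n) : Submodule ℂ (Idx n → ℂ) :=
  LinearMap.ker (Fintype.linearCombination ℂ (fun a => gam a φ))

/-- A nonzero spinor is pure if `N_φ` is maximally isotropic, that is, has dimension `n`. -/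
def IsPure (φ : Spinor n) : Prop := φ ≠ 0 ∧ Module.finrank ℂ (annihilator φ) = n

/-! ### Pseudo-Riemannian manifolds of dimension `2 * n` and complex vector fields -/

section Manifold

variable (n)
variable (M : Type*) [TopologicalSpace M] [ChartedSpace (EuclideanSpace ℝ (Fin (2 * n))) M]

/-- A smooth non-degenerate metric, of any signature, on a manifold of dimension `2 * n`. -/
structure Metric [IsManifold (𝓡 (2 * n)) ∞ M] where
  /-- The inner product on the tangent spaces. -/
  inner (p : M) : TangentSpace (𝓡 (2 * n)) p →L[ℝ] TangentSpace (𝓡 (2 * n)) p →L[ℝ] ℝ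
  symm (p : M) (v w : TangentSpace (𝓡 (2 * n)) p) : inner p v w = inner p w v
  nondegenerate (p : M) (v : TangentSpace (𝓡 (2 * n)) p) (hv : ∀ w, inner p v w = 0) : v = 0
  contMDiff : ContMDiff (𝓡 (2 * n))
    ((𝓡 (2 * n)).prod 𝓘(ℝ, EuclideanSpace ℝ (Fin (2 * n)) →L[ℝ]
      EuclideanSpace ℝ (Fin (2 * n)) →L[ℝ] ℝ)) ∞
    (fun p => Bundle.TotalSpace.mk' (EuclideanSpace ℝ (Fin (2 * n)) →L[ℝ]
      EuclideanSpace ℝ (Fin (2 * n)) →L[ℝ] ℝ) p (inner p))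

/-- A complex vector field, a section of `ℂ ⊗ TM`: the pair `Z p = (x, y)` stands for `x + i y`. -/
abbrev CField := (p : M) → TangentSpace (𝓡 (2 * n)) p × TangentSpace (𝓡 (2 * n)) p

end Manifold

section Fields

variable {M : Type*} [TopologicalSpace M] [ChartedSpace (EuclideanSpace ℝ (Fin (2 * n))) M]

/-- The linear combination `∑ a, v a • e_a` at the point `p`, with complex coefficients. -/
def comb (e : Idx n → CField n M) (v : Idx n → ℂ) (p : M) :
    TangentSpace (𝓡 (2 * n)) p × TangentSpace (𝓡 (2 * n)) p :=
  (∑ a, ((v a).re • (e a p).1 - (v a).im • (e a p).2),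
   ∑ a, ((v a).re • (e a p).2 + (v a).im • (e a p).1))

/-- The derivative `Z f` of a complex function along a complex vector field. -/
def dirDeriv (Z : CField n M) (f : M → ℂ) (p : M) : ℂ :=
  let d : TangentSpace (𝓡 (2 * n)) p →L[ℝ] ℂ := mfderiv (𝓡 (2 * n)) 𝓘(ℝ, ℂ) f p
  d (Z p).1 + Complex.I * d (Z p).2

/-- The Lie bracket of vector fields, extended to complex vector fields. -/
def bracket (X Y : CField n M) : CField n M := fun p =>
  (VectorField.mlieBracket (𝓡 (2 * n)) (fun q => (X q).1) (fun q => (Y q).1) p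
      - VectorField.mlieBracket (𝓡 (2 * n)) (fun q => (X q).2) (fun q => (Y q).2) p,
   VectorField.mlieBracket (𝓡 (2 * n)) (fun q => (X q).1) (fun q => (Y q).2) p
      + VectorField.mlieBracket (𝓡 (2 * n)) (fun q => (X q).2) (fun q => (Y q).1) p)

variable [IsManifold (𝓡 (2 * n)) ∞ M]

/-- Smoothness of a complex vector field on a set. -/
def SmoothFieldOn (Z : CField n M) (U : Set M) : Prop :=
  ContMDiffOn (𝓡 (2 * n)) (𝓡 (2 * n)).tangent ∞
      (fun p => (⟨p, (Z p).1⟩ : TangentBundle (𝓡 (2 * n)) M)) U ∧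
    ContMDiffOn (𝓡 (2 * n)) (𝓡 (2 * n)).tangent ∞
      (fun p => (⟨p, (Z p).2⟩ : TangentBundle (𝓡 (2 * n)) M)) U

/-- The metric has signature `(r, s)`: `r` plus signs and `s` minus signs. -/
def Metric.HasSignature (g : Metric n M) (r s : ℕ) : Prop :=
  ∀ p : M, ∃ b : Module.Basis (Fin r ⊕ Fin s) ℝ (TangentSpace (𝓡 (2 * n)) p),
    ∀ i j, g.inner p (b i) (b j) =
      if i = j then Sum.elim (fun _ => (1 : ℝ)) (fun _ => -1) i else 0

/-- The complex bilinear extension of the metric, as a function of two complex vector fields. -/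
def Metric.pair (g : Metric n M) (X Y : CField n M) (p : M) : ℂ :=
  ((g.inner p (X p).1 (Y p).1 - g.inner p (X p).2 (Y p).2 : ℝ) : ℂ)
    + Complex.I * ((g.inner p (X p).1 (Y p).2 + g.inner p (X p).2 (Y p).1 : ℝ) : ℂ)

/-- `g (∇_X Y, Z)` for the Levi-Civita connection `∇` of `g`, the unique torsion-free connection
compatible with `g`, extended to complex vector fields (Koszul formula). -/
def Metric.leviCivita (g : Metric n M) (X Y Z : CField n M) (p : M) : ℂ :=
  (1 / 2 : ℂ) *
    (dirDeriv X (g.pair Y Z) p + dirDeriv Y (g.pair X Z) p - dirDeriv Z (g.pair X Y) p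
      + g.pair (bracket X Y) Z p - g.pair (bracket X Z) Y p - g.pair (bracket Y Z) X p)

/-- `e = (e_1, …, e_n, θ^1, …, θ^n)` is a smooth frame of `ℂ ⊗ TM` on `U` with
`g (e_i, θ^j) = δ_ij / 2` and `g (e_i, e_j) = 0 = g (θ^i, θ^j)`. -/
def Metric.IsNullFrameOn (g : Metric n M) (e : Idx n → CField n M) (U : Set M) : Prop :=
  (∀ a, SmoothFieldOn (e a) U) ∧ ∀ p ∈ U, ∀ a b, g.pair (e a) (e b) p = eta a b

/-! ### Spinor fields, spinorial connections, twistors -/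

/-- A smooth spinor field (written in the spinor frame `θ^s` of the frame `e`) that is a nonzero
pure spinor at every point of `U`. -/
def IsPureFieldOn (φ : M → Spinor n) (U : Set M) : Prop :=
  ContMDiffOn (𝓡 (2 * n)) 𝓘(ℝ, Spinor n) ∞ φ U ∧ ∀ p ∈ U, IsPure (φ p)

/-- A smooth complex `1`-form on `U`, given by its components `A_a` in the frame `e`. -/
def IsFormOn (A : Idx n → M → ℂ) (U : Set M) : Prop :=
  ∀ a, ContMDiffOn (𝓡 (2 * n)) 𝓘(ℝ, ℂ) ∞ (A a) U

/-- `ω_a^{bc} = g^{bd} g^{cf} ω_{adf}`, where `ω_{adf} = g (∇_a e_d, e_f)`. -/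
def omegaUp (g : Metric n M) (e : Idx n → CField n M) (a b c : Idx n) (p : M) : ℂ :=
  ∑ d, ∑ f, etaInv b d * etaInv c f * g.leviCivita (e a) (e d) (e f) p

/-- The action on spinors of `Ω_a = - 1/4 ω_a^{bc} e_b e_c + A_a`. -/
def Omega (g : Metric n M) (e : Idx n → CField n M) (A : Idx n → M → ℂ) (a : Idx n) (p : M) :
    Spinor n →ₗ[ℂ] Spinor n :=
  (-(1 / 4 : ℂ)) • (∑ b, ∑ c, omegaUp g e a b c p • (gam b ∘ₗ gam c)) + A a p • LinearMap.id

/-- The spinorial connection `∇_a φ = (∂_a φ^s) θ^s + Ω_a · φ`. -/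
def spinConn (g : Metric n M) (e : Idx n → CField n M) (A : Idx n → M → ℂ) (a : Idx n)
    (φ : M → Spinor n) (p : M) : Spinor n :=
  (fun s => dirDeriv (e a) (fun q => φ q s) p) + Omega g e A a p (φ p)

/-- The Dirac operator `D = g^{ab} e_a · ∇_b`. -/
def dirac (g : Metric n M) (e : Idx n → CField n M) (A : Idx n → M → ℂ)
    (φ : M → Spinor n) (p : M) : Spinor n :=
  ∑ a, ∑ b, etaInv a b • gam a (spinConn g e A b φ p)

/-- The twistor operator `T_a = ∇_a - 1/(2n) e_a · D`. -/
def twistorOp (g : Metric n M) (e : Idx n → CField n M) (A : Idx n → M → ℂ) (a : Idx n)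
    (φ : M → Spinor n) (p : M) : Spinor n :=
  spinConn g e A a φ p - (1 / (2 * (n : ℂ))) • gam a (dirac g e A φ p)

/-- `φ` is a twistor on `U` for the spinorial connection with `1`-form `A`. -/
def IsTwistorOn (g : Metric n M) (e : Idx n → CField n M) (A : Idx n → M → ℂ)
    (φ : M → Spinor n) (U : Set M) : Prop :=
  ∀ a, ∀ p ∈ U, twistorOp g e A a φ p = 0

/-- `Z` is at `p` in the distribution generated by `φ`, i.e. in `N_φ` seen inside `ℂ ⊗ T_p M`. -/
def TangentAt (e : Idx n → CField n M) (φ : M → Spinor n) (Z : CField n M) (p : M) : Prop :=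
  ∃ v ∈ annihilator (φ p), Z p = comb e v p

/-- The distribution generated by `φ` is integrable on `U`: the Lie bracket of any two (local)
smooth complex vector fields of the distribution is in the distribution. -/
def IsIntegrableOn (e : Idx n → CField n M) (φ : M → Spinor n) (U : Set M) : Prop :=
  ∀ V : Set M, IsOpen V → V ⊆ U → ∀ X Y : CField n M, SmoothFieldOn X V → SmoothFieldOn Y V →
    (∀ p ∈ V, TangentAt e φ X p) → (∀ p ∈ V, TangentAt e φ Y p) →
      ∀ p ∈ V, TangentAt e φ (bracket X Y) p

end Fields

end PureTwistor

end

open PureTwistor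

/-! Everything rests on one formula. If `X`, `Y` are sections of `N_φ`, the Leibniz rule applied to
`X · φ = 0` gives `(∇_Y X) · φ = -X · ∇_Y φ`. As `∇` has no torsion, `[X, Y] · φ = X · ∇_Y φ - Y ·
∇_X φ` (`exists_bracket_eq`). Hence integrability says that `x · ∇_y φ` is symmetric in `x, y ∈
N_φ`.

For a twistor, `∇_a φ = e_a · χ` with `χ` a multiple of the Dirac derivative, so integrability
follows once `x · y · χ = 0` on `N_φ`. The Leibniz rule also gives `x · ∇_a φ = v · φ` for some
vector `v`. These two facts imply the vanishing by algebra in `IsPure.clif_clif_eq_zero`: a triple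
product `z · x · y · χ` is a multiple of `φ` and is alternating in `z, x, y ∈ N_φ`. It vanishes for
`n = 2` because three vectors of `N_φ` are dependent. For `n ≥ 4` there is a vector outside `N_φ`
orthogonal to all three, which can be moved through the product. For `n = 3` neither argument is
available.

Sections of `N_φ` through a given vector come from `nullVector`: for a fixed functional `l`, the
vector `v` with `⟨v, y⟩ = l (y · φ)` depends linearly on `φ` and lies in `N_φ = N_φ^⊥`, and every
vector of `N_φ` has this form.

In dimension 4 a pure spinor has a chirality, which differentiation preserves, and `φ` and its
derivatives have two components of that chirality. The equations `∇_a φ + A_a φ = e_a · χ` become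
linear equations for the two components of `χ` of the other chirality after eliminating `A_a`. The
symmetry condition is their compatibility condition, and `formSolution_spec` solves them explicitly
with the help of a smooth dual spinor.

The counterexamples are affine spinor fields in flat space, with `z_a` the coordinates dual to a
constant null frame. In dimension 6, `1 + ∑ z_a e_a · θ^{123}` is a pure twistor that is not
integrable. For `n ≥ 3`, `1 + z θ^i ∧ θ^j`, where `z` varies only along `θ^k` with `k ≠ i, j`, is
integrable and not a twistor. -/

namespace PureTwistor

/-! ### Clifford relations and the inner product -/

section Algebra

variable {n : ℕ}

theorem wedge_apply (i : Fin n) (φ : Spinor n) (s : Finset (Fin n)) :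
    wedge i φ s = if i ∈ s then wedgeSign i s * φ (s.erase i) else 0 := rfl

theorem contract_apply (i : Fin n) (φ : Spinor n) (s : Finset (Fin n)) :
    contract i φ s = if i ∈ s then 0 else wedgeSign i s * φ (insert i s) := rfl

theorem wedgeSign_mul_self (i : Fin n) (s : Finset (Fin n)) :
    wedgeSign i s * wedgeSign i s = 1 := by
  simp [wedgeSign, ← pow_add, ← two_mul]

theorem wedgeSign_insert (i j : Fin n) {s : Finset (Fin n)} (hj : j ∉ s) :
    wedgeSign i (insert j s) = (if j < i then -1 else 1) * wedgeSign i s := by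
  unfold wedgeSign
  rw [Finset.filter_insert]
  split_ifs with h
  · rw [Finset.card_insert_of_notMem (by simp [hj]), pow_succ]; ring
  · simp

theorem wedgeSign_erase (i j : Fin n) {s : Finset (Fin n)} (hj : j ∈ s) :
    wedgeSign i (s.erase j) = (if j < i then -1 else 1) * wedgeSign i s := by
  have h := wedgeSign_insert i j (Finset.notMem_erase j s)
  rw [Finset.insert_erase hj] at h
  rw [h]
  split_ifs <;> ring

theorem wedge_wedge_add (i j : Fin n) (φ : Spinor n) :
    wedge i (wedge j φ) + wedge j (wedge i φ) = 0 := by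
  funext s
  simp only [Pi.add_apply, wedge_apply, Finset.mem_erase, Pi.zero_apply]
  rcases lt_trichotomy i j with h | rfl | h
  · by_cases hi : i ∈ s <;> by_cases hj : j ∈ s <;>
      simp [hi, hj, h.ne, h.ne', wedgeSign_erase, h, h.not_gt, Finset.erase_right_comm (a := j)]
    ring
  · simp
  · by_cases hi : i ∈ s <;> by_cases hj : j ∈ s <;>
      simp [hi, hj, h.ne, h.ne', wedgeSign_erase, h, h.not_gt, Finset.erase_right_comm (a := j)]
    ring

theorem contract_contract_add (i j : Fin n) (φ : Spinor n) :
    contract i (contract j φ) + contract j (contract i φ) = 0 := by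
  funext s
  simp only [Pi.add_apply, contract_apply, Finset.mem_insert, Pi.zero_apply]
  rcases lt_trichotomy i j with h | rfl | h
  · by_cases hi : i ∈ s <;> by_cases hj : j ∈ s <;>
      simp [hi, hj, h.ne, h.ne', wedgeSign_insert, h, h.not_gt, Finset.insert_comm j i]
    ring
  · simp
  · by_cases hi : i ∈ s <;> by_cases hj : j ∈ s <;>
      simp [hi, hj, h.ne, h.ne', wedgeSign_insert, h, h.not_gt, Finset.insert_comm j i]
    ring

theorem contract_wedge_add (i j : Fin n) (φ : Spinor n) :
    contract i (wedge j φ) + wedge j (contract i φ) = (if i = j then (1 : ℂ) else 0) • φ := by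
  funext s
  simp only [Pi.add_apply, contract_apply, wedge_apply, Finset.mem_insert, Finset.mem_erase,
    Pi.smul_apply, smul_eq_mul]
  rcases eq_or_ne i j with rfl | h
  · by_cases hi : i ∈ s
    · simp [hi, wedgeSign_erase, ← mul_assoc, wedgeSign_mul_self]
    · simp [hi, wedgeSign_insert, ← mul_assoc, wedgeSign_mul_self]
  · by_cases hi : i ∈ s <;> by_cases hj : j ∈ s
    · simp [hi, hj, h]
    · simp [hi, hj, h]
    · have e : (insert i s).erase j = insert i (s.erase j) := Finset.erase_insert_of_ne h
      rcases lt_or_gt_of_ne h with h' | h' <;>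
      · simp [hi, hj, h, h.symm, wedgeSign_insert, wedgeSign_erase, h', h'.not_gt, e]
        ring
    · simp [hi, hj, h, h.symm]

theorem gam_gam_add (a b : Idx n) (φ : Spinor n) :
    gam a (gam b φ) + gam b (gam a φ) = (2 * eta a b) • φ := by
  rcases a with i | i <;> rcases b with j | j
  · simpa [gam, eta] using contract_contract_add i j φ
  · have h := contract_wedge_add i j φ
    simpa [gam, eta, Matrix.one_apply] using h
  · have h := contract_wedge_add j i φ
    rw [add_comm] at h
    simpa [gam, eta, Matrix.one_apply, eq_comm] using h
  · simpa [gam, eta] using wedge_wedge_add i j φ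

theorem eta_symm (a b : Idx n) : (eta a b : ℂ) = eta b a := by
  rcases a with i | i <;> rcases b with j | j <;> simp [eta, Matrix.one_apply, eq_comm]

theorem etaInv_symm (a b : Idx n) : (etaInv a b : ℂ) = etaInv b a := by
  rcases a with i | i <;> rcases b with j | j <;> simp [etaInv, Matrix.one_apply, eq_comm]

theorem sum_eta_mul_etaInv (a c : Idx n) :
    ∑ b, (eta a b : ℂ) * etaInv b c = if a = c then 1 else 0 := by
  have h := congrFun (congrFun (eta_mul_etaInv (n := n)) a) c
  rwa [Matrix.mul_apply, Matrix.one_apply] at h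

theorem sum_etaInv_mul_eta (a c : Idx n) :
    ∑ b, (etaInv a b : ℂ) * eta b c = if a = c then 1 else 0 := by
  have h₀ : (etaInv : Matrix (Idx n) (Idx n) ℂ) * eta = 1 := mul_eq_one_comm.1 eta_mul_etaInv
  have h := congrFun (congrFun h₀ a) c
  rwa [Matrix.mul_apply, Matrix.one_apply] at h

/-- Clifford multiplication by the vector `∑ a, v a • e_a`. -/
noncomputable def clif : (Idx n → ℂ) →ₗ[ℂ] (Spinor n →ₗ[ℂ] Spinor n) :=
  Fintype.linearCombination ℂ gam

theorem clif_apply (v : Idx n → ℂ) (φ : Spinor n) : clif v φ = ∑ a, v a • gam a φ := by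
  simp [clif, Fintype.linearCombination_apply]

theorem clif_single (a : Idx n) (φ : Spinor n) : clif (Pi.single a 1) φ = gam a φ := by
  simp [clif]

theorem mem_annihilator {φ : Spinor n} {v : Idx n → ℂ} :
    v ∈ annihilator φ ↔ clif v φ = 0 := by
  simp [annihilator, LinearMap.mem_ker, clif_apply, Fintype.linearCombination_apply]

/-- The complex bilinear inner product of vectors given by their components. -/
noncomputable def inn : LinearMap.BilinForm ℂ (Idx n → ℂ) := Matrix.toBilin' eta

theorem inn_apply (v w : Idx n → ℂ) : inn v w = ∑ a, ∑ b, v a * eta a b * w b :=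
  Matrix.toBilin'_apply _ _ _

theorem inn_symm (v w : Idx n → ℂ) : inn v w = inn w v := by
  rw [inn_apply, inn_apply, Finset.sum_comm]
  refine Finset.sum_congr rfl fun a _ => Finset.sum_congr rfl fun b _ => ?_
  rw [eta_symm b a]; ring

theorem inn_nondegenerate : (inn : LinearMap.BilinForm ℂ (Idx n → ℂ)).Nondegenerate := by
  refine Matrix.nondegenerate_toBilin'_iff.2 (Matrix.nondegenerate_of_det_ne_zero ?_)
  exact (Matrix.isUnit_iff_isUnit_det _).1 (IsUnit.of_mul_eq_one _ eta_mul_etaInv) |>.ne_zero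

theorem clif_clif_add (v w : Idx n → ℂ) (φ : Spinor n) :
    clif v (clif w φ) + clif w (clif v φ) = (2 * inn v w) • φ := by
  have h₁ : clif v (clif w φ) = ∑ a, ∑ b, (v a * w b) • gam a (gam b φ) := by
    simp [clif_apply, map_sum, Finset.smul_sum, smul_smul]
  have h₂ : clif w (clif v φ) = ∑ a, ∑ b, (v a * w b) • gam b (gam a φ) := by
    rw [Finset.sum_comm]
    simp [clif_apply, map_sum, Finset.smul_sum, smul_smul, mul_comm]
  rw [h₁, h₂, inn_apply, Finset.mul_sum, Finset.sum_smul, ← Finset.sum_add_distrib]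
  refine Finset.sum_congr rfl fun a _ => ?_
  rw [Finset.mul_sum, Finset.sum_smul, ← Finset.sum_add_distrib]
  refine Finset.sum_congr rfl fun b _ => ?_
  rw [← smul_add, gam_gam_add, smul_smul]
  congr 1; ring

end Algebra

/-! ### Annihilators of pure spinors and the algebraic obstruction -/

section Algebra

variable {n : ℕ}

/-- Both products in `v · w + w · v = 2 ⟨v, w⟩` kill `φ`, which is nonzero. -/
theorem inn_eq_zero_of_mem_annihilator {φ : Spinor n} (hφ : φ ≠ 0) {v w : Idx n → ℂ}
    (hv : v ∈ annihilator φ) (hw : w ∈ annihilator φ) : inn v w = 0 := by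
  have h := clif_clif_add v w φ
  rw [mem_annihilator.1 hv, mem_annihilator.1 hw] at h
  simpa [hφ] using h.symm

theorem annihilator_le_orthogonal {φ : Spinor n} (hφ : φ ≠ 0) :
    annihilator φ ≤ inn.orthogonal (annihilator φ) :=
  fun _ hv _ hw => inn_eq_zero_of_mem_annihilator hφ hw hv

theorem finrank_add_finrank_orthogonal (W : Submodule ℂ (Idx n → ℂ)) :
    Module.finrank ℂ W + Module.finrank ℂ (inn.orthogonal W) = 2 * n := by
  have h := LinearMap.BilinForm.finrank_orthogonal inn_nondegenerate W
  have h' := Submodule.finrank_le W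
  have h'' : Module.finrank ℂ (Idx n → ℂ) = 2 * n := by simp [two_mul]
  omega

theorem IsPure.orthogonal_annihilator {φ : Spinor n} (hφ : IsPure φ) :
    inn.orthogonal (annihilator φ) = annihilator φ := by
  refine (Submodule.eq_of_le_of_finrank_eq (annihilator_le_orthogonal hφ.1) ?_).symm
  have h := finrank_add_finrank_orthogonal (annihilator φ)
  have := hφ.2
  omega

theorem IsPure.mem_annihilator_of_inn {φ : Spinor n} (hφ : IsPure φ) {v : Idx n → ℂ}
    (h : ∀ w ∈ annihilator φ, inn w v = 0) : v ∈ annihilator φ := by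
  rw [← hφ.orthogonal_annihilator]
  exact h

/-- Isotropy bounds the dimension of the annihilator by `n`; vectors with prescribed `e`-components
are independent and give `n` as a lower bound. -/
theorem isPure_of_graph {φ : Spinor n} (hφ : φ ≠ 0)
    (h : ∀ i, ∃ v, clif v φ = 0 ∧ ∀ j, v (Sum.inl j) = if i = j then 1 else 0) : IsPure φ := by
  refine ⟨hφ, le_antisymm ?_ ?_⟩
  · have h₁ := finrank_add_finrank_orthogonal (annihilator φ)
    have h₂ := Submodule.finrank_mono (annihilator_le_orthogonal hφ)
    omega
  · choose v hv hv' using h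
    let v' : Fin n → annihilator φ := fun i => ⟨v i, mem_annihilator.2 (hv i)⟩
    have hli : LinearIndependent ℂ v' := by
      rw [Fintype.linearIndependent_iff]
      intro g hg i
      have := congrFun (congrArg Subtype.val hg) (Sum.inl i)
      simpa [v', Finset.sum_apply, hv'] using this
    simpa using hli.fintype_card_le_finrank

/-- The vector `v` with `⟨v, y⟩ = l (y · φ)` for all `y`. -/
noncomputable def nullVector (l : Spinor n →ₗ[ℂ] ℂ) (φ : Spinor n) : Idx n → ℂ :=
  fun a => ∑ b, etaInv a b * l (gam b φ)

theorem inn_nullVector (l : Spinor n →ₗ[ℂ] ℂ) (φ : Spinor n) (y : Idx n → ℂ) :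
    inn (nullVector l φ) y = l (clif y φ) := by
  rw [inn_symm, inn_apply]
  have h : ∀ a, ∑ b, y a * eta a b * nullVector l φ b = y a * l (gam a φ) := by
    intro a
    simp only [nullVector, mul_assoc, ← Finset.mul_sum]
    congr 1
    simp only [Finset.mul_sum, ← mul_assoc]
    rw [Finset.sum_comm]
    simp only [← Finset.sum_mul, sum_eta_mul_etaInv]
    simp
  simp [h, clif_apply]

/-- For `w ∈ N_φ` the product with the null vector is `l (w · φ) = 0`, and `N_φ` is its own
orthogonal. This supplies sections of `N_φ` that are as smooth as `φ`. -/
theorem IsPure.nullVector_mem {φ : Spinor n} (hφ : IsPure φ) (l : Spinor n →ₗ[ℂ] ℂ) :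
    nullVector l φ ∈ annihilator φ := by
  refine hφ.mem_annihilator_of_inn fun w hw => ?_
  rw [inn_symm, inn_nullVector, mem_annihilator.1 hw, map_zero]

/-- The functional `⟨x, ·⟩` vanishes on `N_φ`, the kernel of `y ↦ y · φ`, so it factors through that
map; the factor is `l`. -/
theorem exists_nullVector_eq {φ : Spinor n} (hφ : φ ≠ 0) {x : Idx n → ℂ}
    (hx : x ∈ annihilator φ) : ∃ l, nullVector l φ = x := by
  have h : (inn x : Module.Dual ℂ (Idx n → ℂ)) ∈
      LinearMap.range ((clif.flip φ).dualMap) := by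
    rw [LinearMap.range_dualMap_eq_dualAnnihilator_ker, Submodule.mem_dualAnnihilator]
    intro w hw
    exact inn_eq_zero_of_mem_annihilator hφ hx (mem_annihilator.2 hw)
  obtain ⟨l, hl⟩ := h
  refine ⟨l, ?_⟩
  have h' : ∀ y, inn (nullVector l φ - x) y = 0 := fun y => by
    rw [map_sub, LinearMap.sub_apply, inn_nullVector, ← hl]
    simp
  exact sub_eq_zero.1 (inn_nondegenerate.1 _ h')

/-- If `χ` is obtained from `φ` by solving the twistor equation, then `χ` is annihilated by
products of two elements of `N_φ`, except in dimension `6`. -/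
theorem IsPure.clif_clif_eq_zero {φ χ : Spinor n} (hφ : IsPure φ) (hn : n = 2 ∨ 4 ≤ n)
    (h : ∀ x ∈ annihilator φ, ∀ a, ∃ v, clif x (clif a χ) = clif v φ)
    {x y : Idx n → ℂ} (hx : x ∈ annihilator φ) (hy : y ∈ annihilator φ) :
    clif x (clif y χ) = 0 := by
  have anti : ∀ {u v : Idx n → ℂ}, u ∈ annihilator φ → v ∈ annihilator φ → ∀ ψ,
      clif u (clif v ψ) = -clif v (clif u ψ) := by
    intro u v hu hv ψ
    have := clif_clif_add u v ψ
    rw [inn_eq_zero_of_mem_annihilator hφ.1 hu hv, mul_zero, zero_smul] at this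
    exact eq_neg_of_add_eq_zero_left this
  have sq : ∀ {u : Idx n → ℂ}, u ∈ annihilator φ → ∀ ψ, clif u (clif u ψ) = 0 := by
    intro u hu ψ
    have := anti hu hu ψ
    exact self_eq_neg.1 this
  -- Write `x · y · χ = v · φ`. Then `z · v · φ = 2 ⟨z, v⟩ φ`, so vanishing triple products put `v`
  -- in `N_φ^⊥ = N_φ`.
  suffices triple : ∀ z ∈ annihilator φ, clif z (clif x (clif y χ)) = 0 by
    obtain ⟨v, hv⟩ := h x hx y
    rw [hv, ← mem_annihilator]
    refine hφ.mem_annihilator_of_inn fun z hz => ?_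
    have h₁ := triple z hz
    have h₂ := clif_clif_add z v φ
    rw [hv] at h₁
    rw [h₁, mem_annihilator.1 hz, map_zero, add_zero] at h₂
    simpa [hφ.1] using h₂.symm
  intro z hz
  rcases hn with rfl | hn
  · have hdep : ¬ LinearIndependent ℂ (![⟨z, hz⟩, ⟨x, hx⟩, ⟨y, hy⟩] : Fin 3 → annihilator φ) := by
      intro hli
      have := hli.fintype_card_le_finrank
      rw [hφ.2] at this
      simp at this
    rw [Fintype.linearIndependent_iff] at hdep
    push Not at hdep
    obtain ⟨g, hg, i, hi⟩ := hdep
    have hg' : g 0 • z + g 1 • x + g 2 • y = 0 := by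
      simpa [Fin.sum_univ_three] using congrArg Subtype.val hg
    -- The relation is inserted in each slot in turn. The triple product is alternating, so only the
    -- term with the missing vector survives.
    have e₀ : g 0 • clif z (clif x (clif y χ)) = 0 := by
      have := congrArg (fun u => clif u (clif x (clif y χ))) hg'
      simpa [sq hx, anti hy hx, sq hy] using this
    have e₁ : g 1 • clif z (clif x (clif y χ)) = 0 := by
      have := congrArg (fun u => clif z (clif u (clif y χ))) hg'
      simpa [sq hz, sq hy] using this
    have e₂ : g 2 • clif z (clif x (clif y χ)) = 0 := by
      have := congrArg (fun u => clif z (clif x (clif u χ))) hg'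
      simpa [anti hx hz, sq hz, sq hx] using this
    fin_cases i
    · exact (smul_eq_zero.1 e₀).resolve_left hi
    · exact (smul_eq_zero.1 e₁).resolve_left hi
    · exact (smul_eq_zero.1 e₂).resolve_left hi
  -- The orthogonal complement of three vectors has dimension at least `2n - 3`, which exceeds `n`
  -- when `n ≥ 4`, so it is not contained in `N_φ`.
  · obtain ⟨a, ha, haφ⟩ : ∃ a, (inn z a = 0 ∧ inn x a = 0 ∧ inn y a = 0) ∧ clif a φ ≠ 0 := by
      by_contra! hcon
      let W : Submodule ℂ (Idx n → ℂ) := Submodule.span ℂ (Set.range ![z, x, y])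
      have hle : inn.orthogonal W ≤ annihilator φ := by
        intro a ha
        refine mem_annihilator.2 (hcon a ⟨ha z ?_, ha x ?_, ha y ?_⟩)
        · exact Submodule.subset_span ⟨0, rfl⟩
        · exact Submodule.subset_span ⟨1, rfl⟩
        · exact Submodule.subset_span ⟨2, rfl⟩
      have h₁ := finrank_add_finrank_orthogonal W
      have h₂ := Submodule.finrank_mono hle
      have h₃ : Module.finrank ℂ W ≤ 3 := by
        exact finrank_range_le_card (R := ℂ) ![z, x, y]
      rw [hφ.2] at h₂
      omega
    have swap : ∀ {u : Idx n → ℂ}, inn u a = 0 → ∀ ψ, clif u (clif a ψ) = -clif a (clif u ψ) := by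
      intro u hu ψ
      have := clif_clif_add u a ψ
      rw [hu, mul_zero, zero_smul] at this
      exact eq_neg_of_add_eq_zero_left this
    have scalar : ∀ {u v : Idx n → ℂ}, u ∈ annihilator φ → v ∈ annihilator φ → ∀ b,
        ∃ c : ℂ, clif u (clif v (clif b χ)) = c • φ := by
      intro u v hu hv b
      obtain ⟨d, hd⟩ := h v hv b
      refine ⟨2 * inn u d, ?_⟩
      have := clif_clif_add u d φ
      rwa [mem_annihilator.1 hu, map_zero, add_zero, ← hd] at this
    obtain ⟨c, hc⟩ := scalar hz hx y
    -- With `a` innermost, `x · y · a · χ` is already a multiple of `φ`, and `z` kills it. Moving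
    -- `a` to the front only changes the sign, so `c • a · φ = 0` with `a · φ ≠ 0`.
    have hzero : clif z (clif x (clif y (clif a χ))) = 0 := by
      obtain ⟨c', hc'⟩ := scalar hx hy a
      rw [hc', map_smul, mem_annihilator.1 hz, smul_zero]
    have := swap ha.2.2 χ
    rw [this, map_neg, map_neg, swap ha.2.1, map_neg, neg_neg, swap ha.1, neg_eq_zero, hc,
      map_smul] at hzero
    rw [hc, (smul_eq_zero.1 hzero).resolve_right haφ, zero_smul]

end Algebra

/-! ### Complex tangent vectors and directional derivatives -/

section Fields

variable {n : ℕ} {M : Type*} [TopologicalSpace M]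
  [ChartedSpace (EuclideanSpace ℝ (Fin (2 * n))) M]

/-- Multiplication of a complex tangent vector `x + i y`, given as `(x, y)`, by a scalar. -/
noncomputable def cmul {p : M} (z : ℂ)
    (w : TangentSpace (𝓡 (2 * n)) p × TangentSpace (𝓡 (2 * n)) p) :
    TangentSpace (𝓡 (2 * n)) p × TangentSpace (𝓡 (2 * n)) p :=
  (z.re • w.1 - z.im • w.2, z.re • w.2 + z.im • w.1)

theorem comb_eq_sum (e : Idx n → CField n M) (v : Idx n → ℂ) (p : M) :
    comb e v p = ∑ a, cmul (v a) (e a p) := by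
  simp [comb, cmul, Prod.ext_iff, Prod.fst_sum, Prod.snd_sum, -Fintype.sum_sum_type]

theorem comb_single (e : Idx n → CField n M) (a : Idx n) (p : M) :
    comb e (Pi.single a 1) p = e a p := by
  rw [comb_eq_sum, Finset.sum_eq_single a]
  · simp [cmul]
  · intro b _ hb
    simp [cmul, hb]
  · simp

theorem comb_add (e : Idx n → CField n M) (v w : Idx n → ℂ) (p : M) :
    comb e (v + w) p = comb e v p + comb e w p := by
  simp only [comb_eq_sum, ← Finset.sum_add_distrib]
  refine Finset.sum_congr rfl fun a _ => ?_
  simp only [cmul, Pi.add_apply, Complex.add_re, Complex.add_im, Prod.mk_add_mk]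
  congr 1 <;> module

theorem comb_smul (e : Idx n → CField n M) (z : ℂ) (v : Idx n → ℂ) (p : M) :
    comb e (z • v) p = cmul z (comb e v p) := by
  simp only [comb, cmul, Pi.smul_apply, smul_eq_mul, Complex.mul_re, Complex.mul_im,
    Finset.smul_sum, ← Finset.sum_sub_distrib, ← Finset.sum_add_distrib]
  congr 1 <;> refine Finset.sum_congr rfl fun a _ => ?_ <;> module

theorem comb_sum {ι : Type*} (s : Finset ι) (e : Idx n → CField n M) (v : ι → Idx n → ℂ) (p : M) :
    comb e (∑ i ∈ s, v i) p = ∑ i ∈ s, comb e (v i) p := by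
  classical
  induction s using Finset.induction_on with
  | empty => simp [comb]
  | insert i s hi ih => rw [Finset.sum_insert hi, Finset.sum_insert hi, comb_add, ih]

/-- A real-linear form on the tangent space, extended complex-linearly to `ℂ ⊗ TM`, applied
to a linear combination. -/
theorem extend_comb (e : Idx n → CField n M) (v : Idx n → ℂ) {p : M}
    (L : TangentSpace (𝓡 (2 * n)) p →ₗ[ℝ] ℂ) :
    L (comb e v p).1 + Complex.I * L (comb e v p).2 =
      ∑ a, v a * (L (e a p).1 + Complex.I * L (e a p).2) := by
  simp only [comb, map_sum, Finset.mul_sum, ← Finset.sum_add_distrib]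
  refine Finset.sum_congr rfl fun a _ => ?_
  simp only [map_sub, map_add, map_smul, Complex.real_smul]
  conv_rhs => rw [← Complex.re_add_im (v a)]
  linear_combination (-(v a).im * L (e a p).2 : ℂ) * Complex.I_sq

theorem dirDeriv_comb (e : Idx n → CField n M) (v : Idx n → ℂ) (f : M → ℂ) {p : M}
    {X : CField n M} (hX : X p = comb e v p) :
    dirDeriv X f p = ∑ a, v a * dirDeriv (e a) f p := by
  simp only [dirDeriv, hX]
  exact extend_comb e v (mfderiv (𝓡 (2 * n)) 𝓘(ℝ, ℂ) f p :
    TangentSpace (𝓡 (2 * n)) p →L[ℝ] ℂ).toLinearMap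

theorem dirDeriv_congr {X : CField n M} {f g : M → ℂ} {p : M} (h : f =ᶠ[nhds p] g) :
    dirDeriv X f p = dirDeriv X g p := by
  simp only [dirDeriv, h.mfderiv_eq]

/-- The differential of a complex function, as a complex-valued form. -/
noncomputable def mder (f : M → ℂ) (p : M) : TangentSpace (𝓡 (2 * n)) p →L[ℝ] ℂ :=
  mfderiv (𝓡 (2 * n)) 𝓘(ℝ, ℂ) f p

theorem dirDeriv_eq (X : CField n M) (f : M → ℂ) (p : M) :
    dirDeriv X f p = mder f p (X p).1 + Complex.I * mder f p (X p).2 := rfl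

theorem dirDeriv_const (X : CField n M) (c : ℂ) (p : M) : dirDeriv X (fun _ => c) p = 0 := by
  have h : ∀ v, mder (n := n) (fun _ : M => c) p v = 0 := fun v => by
    have h' : mder (n := n) (fun _ : M => c) p = 0 := mfderiv_const
    rw [h']; rfl
  rw [dirDeriv_eq, h, h]
  simp

theorem mder_add {f g : M → ℂ} {p : M} (hf : MDifferentiableAt (𝓡 (2 * n)) 𝓘(ℝ, ℂ) f p)
    (hg : MDifferentiableAt (𝓡 (2 * n)) 𝓘(ℝ, ℂ) g p) (v : TangentSpace (𝓡 (2 * n)) p) :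
    mder (fun q => f q + g q) p v = mder f p v + mder g p v :=
  congrArg (fun L : TangentSpace (𝓡 (2 * n)) p →L[ℝ] ℂ => L v) (mfderiv_add hf hg)

theorem mder_mul {f g : M → ℂ} {p : M} (hf : MDifferentiableAt (𝓡 (2 * n)) 𝓘(ℝ, ℂ) f p)
    (hg : MDifferentiableAt (𝓡 (2 * n)) 𝓘(ℝ, ℂ) g p) (v : TangentSpace (𝓡 (2 * n)) p) :
    mder (fun q => f q * g q) p v = f p * mder g p v + g p * mder f p v :=
  congrArg (fun L : TangentSpace (𝓡 (2 * n)) p →L[ℝ] ℂ => L v)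
    (hf.hasMFDerivAt.mul hg.hasMFDerivAt).mfderiv

theorem dirDeriv_add {X : CField n M} {f g : M → ℂ} {p : M}
    (hf : MDifferentiableAt (𝓡 (2 * n)) 𝓘(ℝ, ℂ) f p)
    (hg : MDifferentiableAt (𝓡 (2 * n)) 𝓘(ℝ, ℂ) g p) :
    dirDeriv X (fun q => f q + g q) p = dirDeriv X f p + dirDeriv X g p := by
  simp only [dirDeriv_eq, mder_add hf hg]
  ring

theorem dirDeriv_mul {X : CField n M} {f g : M → ℂ} {p : M}
    (hf : MDifferentiableAt (𝓡 (2 * n)) 𝓘(ℝ, ℂ) f p)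
    (hg : MDifferentiableAt (𝓡 (2 * n)) 𝓘(ℝ, ℂ) g p) :
    dirDeriv X (fun q => f q * g q) p = f p * dirDeriv X g p + g p * dirDeriv X f p := by
  simp only [dirDeriv_eq, mder_mul hf hg]
  ring

theorem dirDeriv_sum {ι : Type*} (s : Finset ι) {X : CField n M} {f : ι → M → ℂ} {p : M}
    (hf : ∀ i, MDifferentiableAt (𝓡 (2 * n)) 𝓘(ℝ, ℂ) (f i) p) :
    MDifferentiableAt (𝓡 (2 * n)) 𝓘(ℝ, ℂ) (fun q => ∑ i ∈ s, f i q) p ∧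
    dirDeriv X (fun q => ∑ i ∈ s, f i q) p = ∑ i ∈ s, dirDeriv X (f i) p := by
  classical
  induction s using Finset.induction_on with
  | empty => simpa using ⟨mdifferentiableAt_const, dirDeriv_const X 0 p⟩
  | insert i s hi ih =>
    simp only [Finset.sum_insert hi]
    exact ⟨(hf i).add ih.1, by rw [dirDeriv_add (hf i) ih.1, ih.2]⟩

theorem contMDiffOn_mul {f h : M → ℂ} {U : Set M} (hf : ContMDiffOn (𝓡 (2 * n)) 𝓘(ℝ, ℂ) ∞ f U)
    (hh : ContMDiffOn (𝓡 (2 * n)) 𝓘(ℝ, ℂ) ∞ h U) :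
    ContMDiffOn (𝓡 (2 * n)) 𝓘(ℝ, ℂ) ∞ (fun q => f q * h q) U :=
  (contDiff_mul (𝕜 := ℝ) (𝔸 := ℂ)).contMDiff.comp_contMDiffOn (hf.prodMk_space hh)

end Fields

/-! ### The Lie bracket of complex vector fields -/

section Fields

variable {n : ℕ} {M : Type*} [TopologicalSpace M]
  [ChartedSpace (EuclideanSpace ℝ (Fin (2 * n))) M]

theorem bracket_swap (X Y : CField n M) (p : M) : bracket X Y p = -bracket Y X p := by
  simp only [bracket]
  rw [VectorField.mlieBracket_swap_apply (V := fun q => (X q).1) (W := fun q => (Y q).1),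
    VectorField.mlieBracket_swap_apply (V := fun q => (X q).2) (W := fun q => (Y q).2),
    VectorField.mlieBracket_swap_apply (V := fun q => (X q).1) (W := fun q => (Y q).2),
    VectorField.mlieBracket_swap_apply (V := fun q => (X q).2) (W := fun q => (Y q).1),
    Prod.neg_mk]
  congr 1 <;> abel

theorem bracket_congr {X X' Y Y' : CField n M} {p : M} (hX : ∀ᶠ q in nhds p, X q = X' q)
    (hY : ∀ᶠ q in nhds p, Y q = Y' q) : bracket X Y p = bracket X' Y' p := by
  have h₁ : ∀ {Z Z' : CField n M}, (∀ᶠ q in nhds p, Z q = Z' q) →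
      (fun q => (Z q).1) =ᶠ[nhds p] fun q => (Z' q).1 := fun h => h.mono fun q hq =>
        congrArg Prod.fst hq
  have h₂ : ∀ {Z Z' : CField n M}, (∀ᶠ q in nhds p, Z q = Z' q) →
      (fun q => (Z q).2) =ᶠ[nhds p] fun q => (Z' q).2 := fun h => h.mono fun q hq =>
        congrArg Prod.snd hq
  simp only [bracket]
  rw [(h₁ hX).mlieBracket_vectorField_eq (h₁ hY), (h₁ hX).mlieBracket_vectorField_eq (h₂ hY),
    (h₂ hX).mlieBracket_vectorField_eq (h₁ hY), (h₂ hX).mlieBracket_vectorField_eq (h₂ hY)]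

theorem bracket_zero_right (X : CField n M) (p : M) : bracket X (fun _ => 0) p = 0 := by
  have h : ∀ V : Π q : M, TangentSpace (𝓡 (2 * n)) q,
      VectorField.mlieBracket (𝓡 (2 * n)) V (fun _ => 0) p = 0 := fun V =>
    congrFun VectorField.mlieBracket_zero_right p
  simp only [bracket, Prod.fst_zero, Prod.snd_zero, h]
  simp

theorem mdifferentiableAt_re_im {f : M → ℂ} {p : M}
    (hf : MDifferentiableAt (𝓡 (2 * n)) 𝓘(ℝ, ℂ) f p) :
    (MDifferentiableAt (𝓡 (2 * n)) 𝓘(ℝ, ℝ) (fun q => (f q).re) p ∧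
      ∀ v, mvfderiv (𝓡 (2 * n)) (fun q => (f q).re) p v = (mder f p v).re) ∧
    (MDifferentiableAt (𝓡 (2 * n)) 𝓘(ℝ, ℝ) (fun q => (f q).im) p ∧
      ∀ v, mvfderiv (𝓡 (2 * n)) (fun q => (f q).im) p v = (mder f p v).im) := by
  have h₁ := Complex.reCLM.hasMFDerivAt.comp p hf.hasMFDerivAt
  have h₂ := Complex.imCLM.hasMFDerivAt.comp p hf.hasMFDerivAt
  exact ⟨⟨h₁.mdifferentiableAt, fun v => congrArg
      (fun L : TangentSpace (𝓡 (2 * n)) p →L[ℝ] ℝ => L v) h₁.mfderiv⟩,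
    ⟨h₂.mdifferentiableAt, fun v => congrArg
      (fun L : TangentSpace (𝓡 (2 * n)) p →L[ℝ] ℝ => L v) h₂.mfderiv⟩⟩

variable [IsManifold (𝓡 (2 * n)) ∞ M]

/-- Differentiability of a complex vector field at a point. -/
def DiffFieldAt (Z : CField n M) (p : M) : Prop :=
  MDifferentiableAt (𝓡 (2 * n)) (𝓡 (2 * n)).tangent
      (fun q => (⟨q, (Z q).1⟩ : TangentBundle (𝓡 (2 * n)) M)) p ∧
    MDifferentiableAt (𝓡 (2 * n)) (𝓡 (2 * n)).tangent
      (fun q => (⟨q, (Z q).2⟩ : TangentBundle (𝓡 (2 * n)) M)) p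

theorem SmoothFieldOn.diffFieldAt {Z : CField n M} {U : Set M} (hZ : SmoothFieldOn Z U)
    (hU : IsOpen U) {p : M} (hp : p ∈ U) : DiffFieldAt Z p :=
  ⟨(hZ.1.contMDiffAt (hU.mem_nhds hp)).mdifferentiableAt (by simp),
    (hZ.2.contMDiffAt (hU.mem_nhds hp)).mdifferentiableAt (by simp)⟩

theorem DiffFieldAt.add {X Y : CField n M} {p : M} (hX : DiffFieldAt X p) (hY : DiffFieldAt Y p) :
    DiffFieldAt (fun q => X q + Y q) p :=
  ⟨mdifferentiableAt_add_section hX.1 hY.1, mdifferentiableAt_add_section hX.2 hY.2⟩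

theorem bracket_add_right (X : CField n M) {Y Z : CField n M} {p : M} (hY : DiffFieldAt Y p)
    (hZ : DiffFieldAt Z p) :
    bracket X (fun q => Y q + Z q) p = bracket X Y p + bracket X Z p := by
  have h := VectorField.mlieBracket_add_right (V := fun q => (X q).1) hY.1 hZ.1
  have h' := VectorField.mlieBracket_add_right (V := fun q => (X q).2) hY.1 hZ.1
  have k := VectorField.mlieBracket_add_right (V := fun q => (X q).1) hY.2 hZ.2
  have k' := VectorField.mlieBracket_add_right (V := fun q => (X q).2) hY.2 hZ.2
  simp only [bracket, Prod.mk_add_mk]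
  refine Prod.ext ?_ ?_
  · exact (congrArg₂ (· - ·) h k').trans (add_sub_add_comm _ _ _ _)
  · exact (congrArg₂ (· + ·) k h').trans (add_add_add_comm _ _ _ _)

theorem DiffFieldAt.cmul {X : CField n M} {f : M → ℂ} {p : M} (hX : DiffFieldAt X p)
    (hf : MDifferentiableAt (𝓡 (2 * n)) 𝓘(ℝ, ℂ) f p) :
    DiffFieldAt (fun q => cmul (f q) (X q)) p := by
  obtain ⟨⟨hr, -⟩, ⟨hi, -⟩⟩ := mdifferentiableAt_re_im hf
  exact ⟨mdifferentiableAt_sub_section (hr.smul_section hX.1) (hi.smul_section hX.2),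
    mdifferentiableAt_add_section (hr.smul_section hX.2) (hi.smul_section hX.1)⟩

/-- The complex Leibniz rule is assembled from the real one, applied to the real and imaginary parts
of `f` and of the fields. -/
theorem bracket_cmul_right (X : CField n M) {Y : CField n M} {f : M → ℂ} {p : M}
    (hf : MDifferentiableAt (𝓡 (2 * n)) 𝓘(ℝ, ℂ) f p) (hY : DiffFieldAt Y p) :
    bracket X (fun q => cmul (f q) (Y q)) p =
      cmul (dirDeriv X f p) (Y p) + cmul (f p) (bracket X Y p) := by
  obtain ⟨⟨hr, hr'⟩, ⟨hi, hi'⟩⟩ := mdifferentiableAt_re_im hf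
  have key₁ : ∀ V : Π q : M, TangentSpace (𝓡 (2 * n)) q,
      VectorField.mlieBracket (𝓡 (2 * n)) V
        (fun q => (f q).re • (Y q).1 - (f q).im • (Y q).2) p =
      (mder f p (V p)).re • (Y p).1
        + (f p).re • VectorField.mlieBracket (𝓡 (2 * n)) V (fun q => (Y q).1) p
        - ((mder f p (V p)).im • (Y p).2
        + (f p).im • VectorField.mlieBracket (𝓡 (2 * n)) V (fun q => (Y q).2) p) := by
    intro V
    have hs := VectorField.mlieBracket_add_right (V := V) (hr.smul_section hY.1)
      (mdifferentiableAt_neg_section (hi.smul_section hY.2))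
    have hn := VectorField.mlieBracket_const_smul_right (V := V) (c := (-1 : ℝ))
      (hi.smul_section hY.2)
    have h₁ := VectorField.mlieBracket_smul_right (V := V) hr hY.1
    have h₂ := VectorField.mlieBracket_smul_right (V := V) hi hY.2
    rw [hr'] at h₁
    rw [hi'] at h₂
    rw [h₂, neg_one_smul, neg_one_smul] at hn
    rw [h₁] at hs
    have e : (fun q => (f q).re • (Y q).1 - (f q).im • (Y q).2) =
        ((fun q => (f q).re) • fun q => (Y q).1) + -((fun q => (f q).im) • fun q => (Y q).2) := by
      funext q
      exact sub_eq_add_neg _ _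
    rw [e]
    refine hs.trans ?_
    rw [sub_eq_add_neg]
    exact congrArg _ hn
  have key₂ : ∀ V : Π q : M, TangentSpace (𝓡 (2 * n)) q,
      VectorField.mlieBracket (𝓡 (2 * n)) V
        (fun q => (f q).re • (Y q).2 + (f q).im • (Y q).1) p =
      (mder f p (V p)).re • (Y p).2
        + (f p).re • VectorField.mlieBracket (𝓡 (2 * n)) V (fun q => (Y q).2) p
        + ((mder f p (V p)).im • (Y p).1
        + (f p).im • VectorField.mlieBracket (𝓡 (2 * n)) V (fun q => (Y q).1) p) := by
    intro V
    have hs := VectorField.mlieBracket_add_right (V := V) (hr.smul_section hY.2)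
      (hi.smul_section hY.1)
    have h₁ := VectorField.mlieBracket_smul_right (V := V) hr hY.2
    have h₂ := VectorField.mlieBracket_smul_right (V := V) hi hY.1
    rw [hr'] at h₁
    rw [hi'] at h₂
    rw [h₁, h₂] at hs
    exact hs
  simp only [bracket, PureTwistor.cmul, key₁, key₂, dirDeriv_eq, Complex.add_re, Complex.add_im,
    Complex.mul_re, Complex.mul_im, Complex.I_re, Complex.I_im, Prod.mk_add_mk]
  congr 1 <;> module

theorem bracket_cmul_left {X : CField n M} (Y : CField n M) {f : M → ℂ} {p : M}
    (hf : MDifferentiableAt (𝓡 (2 * n)) 𝓘(ℝ, ℂ) f p) (hX : DiffFieldAt X p) :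
    bracket (fun q => cmul (f q) (X q)) Y p =
      -cmul (dirDeriv Y f p) (X p) + cmul (f p) (bracket X Y p) := by
  rw [bracket_swap, bracket_cmul_right Y hf hX, bracket_swap Y X]
  simp only [PureTwistor.cmul, Prod.neg_mk, Prod.mk_add_mk, Prod.fst_neg, Prod.snd_neg]
  congr 1 <;> module

theorem bracket_sum_right {ι : Type*} (s : Finset ι) (X : CField n M) {Y : ι → CField n M} {p : M}
    (hY : ∀ i, DiffFieldAt (Y i) p) :
    DiffFieldAt (fun q => ∑ i ∈ s, Y i q) p ∧
      bracket X (fun q => ∑ i ∈ s, Y i q) p = ∑ i ∈ s, bracket X (Y i) p := by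
  classical
  induction s using Finset.induction_on with
  | empty =>
    simp only [Finset.sum_empty]
    refine ⟨⟨?_, ?_⟩, bracket_zero_right X p⟩ <;>
    exact Bundle.mdifferentiable_zeroSection ℝ (TangentSpace (𝓡 (2 * n)) : M → Type _) p
  | insert i s hi ih =>
    simp only [Finset.sum_insert hi]
    exact ⟨(hY i).add ih.1, by rw [bracket_add_right X (hY i) ih.1, ih.2]⟩

theorem bracket_sum_left {ι : Type*} (s : Finset ι) {X : ι → CField n M} (Y : CField n M) {p : M}
    (hX : ∀ i, DiffFieldAt (X i) p) :
    bracket (fun q => ∑ i ∈ s, X i q) Y p = ∑ i ∈ s, bracket (X i) Y p := by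
  rw [bracket_swap, (bracket_sum_right s Y hX).2, ← Finset.sum_neg_distrib]
  exact Finset.sum_congr rfl fun i _ => (bracket_swap _ _ _).symm

end Fields

/-! ### The Levi-Civita connection in a null frame -/

section Fields

variable {n : ℕ} {M : Type*} [TopologicalSpace M]
  [ChartedSpace (EuclideanSpace ℝ (Fin (2 * n))) M] [IsManifold (𝓡 (2 * n)) ∞ M]

/-- The Lie bracket of linear combinations of the fields of a frame. -/
theorem bracket_eq_comb {e : Idx n → CField n M} {p : M} (he : ∀ a, DiffFieldAt (e a) p)
    {t : Idx n → Idx n → Idx n → ℂ} (ht : ∀ a b, bracket (e a) (e b) p = comb e (t a b) p)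
    {x y : M → Idx n → ℂ} (hx : ∀ a, MDifferentiableAt (𝓡 (2 * n)) 𝓘(ℝ, ℂ) (fun q => x q a) p)
    (hy : ∀ a, MDifferentiableAt (𝓡 (2 * n)) 𝓘(ℝ, ℂ) (fun q => y q a) p) {X Y : CField n M}
    (hX : ∀ᶠ q in nhds p, X q = comb e (x q) q)
    (hY : ∀ᶠ q in nhds p, Y q = comb e (y q) q) :
    bracket X Y p = comb e (fun c => dirDeriv X (fun q => y q c) p - dirDeriv Y (fun q => x q c) p
      + ∑ a, ∑ b, x p a * y p b * t a b c) p := by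
  have h₁ : bracket X Y p = ∑ b, (cmul (dirDeriv X (fun q => y q b) p) (e b p)
      + cmul (y p b) (bracket X (e b) p)) := by
    simp only [comb_eq_sum] at hY
    rw [bracket_congr (Filter.Eventually.of_forall fun q => rfl) hY,
      (bracket_sum_right _ X fun b => (he b).cmul (hy b)).2]
    exact Finset.sum_congr rfl fun b _ => bracket_cmul_right X (hy b) (he b)
  have h₂ : ∀ b, bracket X (e b) p = ∑ a, (-cmul (dirDeriv (e b) (fun q => x q a) p) (e a p)
      + cmul (x p a) (bracket (e a) (e b) p)) := by
    intro b
    simp only [comb_eq_sum] at hX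
    rw [bracket_congr hX (Filter.Eventually.of_forall fun q => rfl),
      bracket_sum_left _ (e b) fun a => (he a).cmul (hx a)]
    exact Finset.sum_congr rfl fun a _ => bracket_cmul_left (e b) (hx a) (he a)
  have hneg : ∀ (z : ℂ) (a : Idx n), -cmul z (e a p) = comb e (-z • Pi.single a 1) p := by
    intro z a
    rw [comb_smul, comb_single]
    simp only [cmul, Prod.neg_mk, Complex.neg_re, Complex.neg_im]
    congr 1 <;> module
  have hpos : ∀ (z : ℂ) (a : Idx n), cmul z (e a p) = comb e (z • Pi.single a 1) p := by
    intro z a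
    rw [comb_smul, comb_single]
  simp only [h₁, h₂, ht, hneg]
  simp only [hpos, ← comb_smul, ← comb_add, ← comb_sum]
  congr 1
  funext c
  rw [dirDeriv_comb e _ (fun q => x q c) hY.self_of_nhds]
  simp only [Finset.sum_apply, Pi.add_apply, Pi.smul_apply, Pi.single_apply, smul_eq_mul,
    mul_ite, mul_one, mul_zero, Finset.sum_add_distrib, Finset.mul_sum, mul_add,
    Finset.sum_ite_eq, Finset.mem_univ, if_true, mul_neg, Finset.sum_neg_distrib]
  rw [Finset.sum_comm (f := fun a b => x p a * y p b * t a b c)]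
  simp only [sub_eq_add_neg, ← Finset.sum_neg_distrib, ← add_assoc]
  congr 1
  refine Finset.sum_congr rfl fun b _ => Finset.sum_congr rfl fun a _ => ?_
  ring

variable (g : Metric n M)

theorem Metric.pair_comm (X Y : CField n M) : g.pair X Y = g.pair Y X := by
  funext p
  simp only [Metric.pair, g.symm p (X p).1, g.symm p (X p).2]
  rw [add_comm (g.inner p (Y p).2 (X p).1)]

theorem Metric.pair_comb_left (e : Idx n → CField n M) (v : Idx n → ℂ) {X : CField n M} {p : M}
    (hX : X p = comb e v p) (Y : CField n M) : g.pair X Y p = ∑ a, v a * g.pair (e a) Y p := by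
  let L : TangentSpace (𝓡 (2 * n)) p →ₗ[ℝ] ℂ :=
    Complex.ofRealCLM.toLinearMap ∘ₗ (g.inner p (Y p).1).toLinearMap +
      Complex.I • (Complex.ofRealCLM.toLinearMap ∘ₗ (g.inner p (Y p).2).toLinearMap)
  have hL : ∀ Z : CField n M, g.pair Z Y p = L (Z p).1 + Complex.I * L (Z p).2 := by
    intro Z
    rw [g.pair_comm]
    simp only [Metric.pair, L, LinearMap.add_apply, LinearMap.smul_apply, LinearMap.comp_apply,
      ContinuousLinearMap.coe_coe, Complex.ofRealCLM_apply,
      smul_eq_mul]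
    push_cast
    linear_combination (-(g.inner p (Y p).2 (Z p).2) : ℂ) * Complex.I_sq
  simp only [hL, hX]
  exact extend_comb e v L

theorem Metric.contMDiffOn_pair {X Y : CField n M} {U : Set M} (hX : SmoothFieldOn X U)
    (hY : SmoothFieldOn Y U) : ContMDiffOn (𝓡 (2 * n)) 𝓘(ℝ, ℂ) ∞ (g.pair X Y) U := by
  have key : ∀ {V W : Π q : M, TangentSpace (𝓡 (2 * n)) q},
      ContMDiffOn (𝓡 (2 * n)) (𝓡 (2 * n)).tangent ∞
        (fun p => (⟨p, V p⟩ : TangentBundle (𝓡 (2 * n)) M)) U →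
      ContMDiffOn (𝓡 (2 * n)) (𝓡 (2 * n)).tangent ∞
        (fun p => (⟨p, W p⟩ : TangentBundle (𝓡 (2 * n)) M)) U →
      ContMDiffOn (𝓡 (2 * n)) 𝓘(ℝ, ℂ) ∞ (fun p => ((g.inner p (V p) (W p) : ℝ) : ℂ)) U := by
    intro V W hV hW p hp
    have : ContMDiffWithinAt (𝓡 (2 * n)) ((𝓡 (2 * n)).prod 𝓘(ℝ)) ∞
        (fun q => Bundle.TotalSpace.mk' ℝ (E := Bundle.Trivial M ℝ) q
          (g.inner q (V q) (W q))) U p := by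
      apply ContMDiffWithinAt.clm_bundle_apply₂ (F₁ := EuclideanSpace ℝ (Fin (2 * n)))
        (F₂ := EuclideanSpace ℝ (Fin (2 * n)))
      · exact g.contMDiff.contMDiffAt.contMDiffWithinAt
      · exact hV p hp
      · exact hW p hp
    simp only [Bundle.contMDiffWithinAt_totalSpace] at this
    exact Complex.ofRealCLM.contDiff.contMDiff.contMDiffAt.comp_contMDiffWithinAt p this.2
  have h := ((key hX.1 hY.1).sub (key hX.2 hY.2)).add
    (contMDiffOn_mul (contMDiffOn_const (c := Complex.I)) ((key hX.1 hY.2).add (key hX.2 hY.1)))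
  refine h.congr fun p _ => ?_
  simp [Metric.pair]

/-- The Koszul formula encodes vanishing torsion; its other half, compatibility with the metric, is
`Metric.leviCivita_add_swap`. -/
theorem Metric.leviCivita_sub_swap (X Y Z : CField n M) (p : M) :
    g.leviCivita X Y Z p - g.leviCivita Y X Z p = g.pair (bracket X Y) Z p := by
  have h : g.pair (bracket Y X) Z p = -g.pair (bracket X Y) Z p := by
    simp only [Metric.pair, bracket_swap Y X, Prod.fst_neg, Prod.snd_neg, map_neg,
      neg_apply]
    push_cast
    ring
  simp only [Metric.leviCivita, h, g.pair_comm Y X]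
  ring

theorem Metric.leviCivita_add_swap (X Y Z : CField n M) (p : M) :
    g.leviCivita X Y Z p + g.leviCivita X Z Y p = dirDeriv X (g.pair Y Z) p := by
  have h : g.pair (bracket Z Y) X p = -g.pair (bracket Y Z) X p := by
    simp only [Metric.pair, bracket_swap Z Y, Prod.fst_neg, Prod.snd_neg, map_neg,
      neg_apply]
    push_cast
    ring
  simp only [Metric.leviCivita, h, g.pair_comm Z Y]
  ring

variable {g} {e : Idx n → CField n M} {U : Set M}

theorem Metric.IsNullFrameOn.dirDeriv_pair (he : g.IsNullFrameOn e U) (hU : IsOpen U) {p : M}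
    (hp : p ∈ U) (X : CField n M) (a b : Idx n) : dirDeriv X (g.pair (e a) (e b)) p = 0 := by
  rw [dirDeriv_congr (g := fun _ => eta a b), dirDeriv_const]
  filter_upwards [hU.mem_nhds hp] with q hq using he.2 q hq a b

theorem Metric.IsNullFrameOn.leviCivita_antisymm (he : g.IsNullFrameOn e U) (hU : IsOpen U) {p : M}
    (hp : p ∈ U) (X : CField n M) (a b : Idx n) :
    g.leviCivita X (e a) (e b) p = -g.leviCivita X (e b) (e a) p := by
  rw [eq_neg_iff_add_eq_zero, Metric.leviCivita_add_swap, he.dirDeriv_pair hU hp]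

theorem Metric.IsNullFrameOn.coeff (he : g.IsNullFrameOn e U) {p : M} (hp : p ∈ U)
    {X : CField n M} {v : Idx n → ℂ} (hX : X p = comb e v p) (c : Idx n) :
    v c = ∑ d, g.pair X (e d) p * etaInv d c := by
  simp only [g.pair_comb_left e v hX, he.2 p hp, Finset.sum_mul, mul_assoc]
  rw [Finset.sum_comm]
  simp only [← Finset.mul_sum, sum_eta_mul_etaInv]
  simp

/-- The inner products recover the coefficients, so `comb` is injective; source and target both have
real dimension `4 * n`. -/
theorem Metric.IsNullFrameOn.exists_eq_comb (he : g.IsNullFrameOn e U) {p : M} (hp : p ∈ U)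
    (w : TangentSpace (𝓡 (2 * n)) p × TangentSpace (𝓡 (2 * n)) p) : ∃ v, w = comb e v p := by
  let L : (Idx n → ℂ) →ₗ[ℝ] TangentSpace (𝓡 (2 * n)) p × TangentSpace (𝓡 (2 * n)) p :=
    { toFun := fun v => comb e v p
      map_add' := fun v w => comb_add e v w p
      map_smul' := fun r v => by
        have := comb_smul e (r : ℂ) v p
        simp only [cmul, Complex.ofReal_re, Complex.ofReal_im, zero_smul, sub_zero, add_zero]
          at this
        rw [← Complex.coe_smul]
        exact this }
  have hinj : Function.Injective L := by
    rw [← LinearMap.ker_eq_bot, LinearMap.ker_eq_bot']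
    intro v hv
    funext c
    have h := he.coeff hp (X := fun _ => 0) (v := v) hv.symm c
    simpa [Metric.pair] using h
  have hfin : FiniteDimensional ℝ (TangentSpace (𝓡 (2 * n)) p) :=
    inferInstanceAs (FiniteDimensional ℝ (EuclideanSpace ℝ (Fin (2 * n))))
  have hdim : Module.finrank ℝ (TangentSpace (𝓡 (2 * n)) p) = 2 * n :=
    finrank_euclideanSpace_fin
  have hrank : Module.finrank ℝ (Idx n → ℂ) =
      Module.finrank ℝ (TangentSpace (𝓡 (2 * n)) p × TangentSpace (𝓡 (2 * n)) p) := by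
    rw [Module.finrank_prod, hdim, Module.finrank_pi_fintype]
    simp [Complex.finrank_real_complex]
    ring
  obtain ⟨v, hv⟩ := (LinearMap.injective_iff_surjective_of_finrank_eq_finrank hrank).1 hinj w
  exact ⟨v, hv.symm⟩

theorem Metric.IsNullFrameOn.eq_comb (he : g.IsNullFrameOn e U) {p : M} (hp : p ∈ U)
    (X : CField n M) : X p = comb e (fun c => ∑ d, g.pair X (e d) p * etaInv d c) p := by
  obtain ⟨v, hv⟩ := he.exists_eq_comb hp (X p)
  rw [hv]
  congr 1
  funext c
  exact he.coeff hp hv c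

end Fields

/-! ### The action of bivectors on vectors -/

section Algebra

variable {n : ℕ}

theorem gam_gam_commutator (a b c : Idx n) (ψ : Spinor n) :
    gam b (gam c (gam a ψ)) - gam a (gam b (gam c ψ)) =
      (2 * eta c a) • gam b ψ - (2 * eta b a) • gam c ψ := by
  have h₁ := congrArg (gam b) (gam_gam_add c a ψ)
  have h₂ := gam_gam_add b a (gam c ψ)
  rw [map_add, map_smul] at h₁
  rw [← h₁, ← h₂]
  abel

/-- An antisymmetric quadratic element acts on vectors, by commutator, as an infinitesimal rotation.
Antisymmetry merges the two terms of `gam_gam_commutator`; the resulting factor 4 is what the `-1/4`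
in `Omega` cancels. -/
theorem commutator_sum_gam_gam (m : Idx n → Idx n → ℂ) (hm : ∀ b c, m b c = -m c b) (a : Idx n)
    (ψ : Spinor n) :
    ∑ b, ∑ c, m b c • gam b (gam c (gam a ψ)) - gam a (∑ b, ∑ c, m b c • gam b (gam c ψ)) =
      -∑ c, (4 * ∑ b, eta a b * m b c) • gam c ψ := by
  have h₁ : ∑ b, ∑ c, m b c • gam b (gam c (gam a ψ))
      - gam a (∑ b, ∑ c, m b c • gam b (gam c ψ)) =
      ∑ b, ∑ c, ((m b c * (2 * eta c a)) • gam b ψ - (m b c * (2 * eta b a)) • gam c ψ) := by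
    simp only [map_sum, map_smul, ← Finset.sum_sub_distrib, ← smul_sub, gam_gam_commutator]
    simp only [smul_sub, smul_smul]
  have h₂ : ∑ b, ∑ c, (m b c * (2 * eta c a)) • gam b ψ =
      -∑ c, (2 * ∑ b, eta a b * m b c) • gam c ψ := by
    simp only [Finset.mul_sum, Finset.sum_smul, ← Finset.sum_neg_distrib]
    refine Finset.sum_congr rfl fun b _ => Finset.sum_congr rfl fun c _ => ?_
    rw [hm b c, eta_symm c a, ← neg_smul]
    congr 1; ring
  have h₃ : ∑ b, ∑ c, (m b c * (2 * eta b a)) • gam c ψ =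
      ∑ c, (2 * ∑ b, eta a b * m b c) • gam c ψ := by
    rw [Finset.sum_comm]
    simp only [Finset.mul_sum, Finset.sum_smul]
    refine Finset.sum_congr rfl fun b _ => Finset.sum_congr rfl fun c _ => ?_
    rw [eta_symm c a]
    congr 1; ring
  rw [h₁]
  simp only [Finset.sum_sub_distrib]
  rw [h₂, h₃, ← Finset.sum_neg_distrib, ← Finset.sum_neg_distrib, ← Finset.sum_sub_distrib]
  refine Finset.sum_congr rfl fun c _ => ?_
  module

end Algebra

/-! ### The spinorial connection and the bracket formula -/

section Fields

variable {n : ℕ} {M : Type*} [TopologicalSpace M]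
  [ChartedSpace (EuclideanSpace ℝ (Fin (2 * n))) M]

/-- The derivative of the components of a spinor field along a complex vector field. -/
noncomputable def spinDeriv (X : CField n M) (φ : M → Spinor n) (p : M) : Spinor n :=
  fun s => dirDeriv X (fun q => φ q s) p

theorem mdifferentiableAt_linear {φ : M → Spinor n} {p : M}
    (hφ : ∀ s, MDifferentiableAt (𝓡 (2 * n)) 𝓘(ℝ, ℂ) (fun q => φ q s) p)
    (l : Spinor n →ₗ[ℂ] ℂ) (X : CField n M) :
    MDifferentiableAt (𝓡 (2 * n)) 𝓘(ℝ, ℂ) (fun q => l (φ q)) p ∧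
      dirDeriv X (fun q => l (φ q)) p = l (spinDeriv X φ p) := by
  have h : ∀ ψ, l ψ = ∑ s, ψ s * l (Pi.single s 1) := fun ψ => by
    conv_lhs => rw [LinearMap.pi_apply_eq_sum_univ l ψ]
    refine Finset.sum_congr rfl fun s _ => ?_
    rw [smul_eq_mul]
    congr 2
    funext t
    simp [Pi.single_apply, eq_comm]
  have h' : (fun q => l (φ q)) = fun q => ∑ s, φ q s * l (Pi.single s 1) := funext fun q => h (φ q)
  rw [h', h (spinDeriv X φ p)]
  have h₁ := dirDeriv_sum (X := X) Finset.univ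
    (fun s => (hφ s).mul (mdifferentiableAt_const (c := l (Pi.single s 1))))
  refine ⟨h₁.1, h₁.2.trans (Finset.sum_congr rfl fun s _ => ?_)⟩
  refine (dirDeriv_mul (hφ s) (mdifferentiableAt_const (c := l (Pi.single s 1)))).trans ?_
  rw [dirDeriv_const, mul_zero, zero_add, mul_comm]
  rfl

/-- Differentiate the identity `v · φ = 0`, component by component. -/
theorem clif_spinDeriv {φ : M → Spinor n} {p : M}
    (hφ : ∀ s, MDifferentiableAt (𝓡 (2 * n)) 𝓘(ℝ, ℂ) (fun q => φ q s) p) {v : M → Idx n → ℂ}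
    (hv : ∀ a, MDifferentiableAt (𝓡 (2 * n)) 𝓘(ℝ, ℂ) (fun q => v q a) p)
    (h : ∀ᶠ q in nhds p, v q ∈ annihilator (φ q)) (X : CField n M) :
    clif (v p) (spinDeriv X φ p) = -clif (fun a => dirDeriv X (fun q => v q a) p) (φ p) := by
  rw [eq_neg_iff_add_eq_zero]
  funext s
  have hl := fun a => mdifferentiableAt_linear hφ (LinearMap.proj s ∘ₗ gam a) X
  have h₁ : dirDeriv X (fun q => ∑ a, v q a * (LinearMap.proj s ∘ₗ gam a) (φ q)) p = 0 := by
    rw [dirDeriv_congr (g := fun _ => 0), dirDeriv_const]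
    filter_upwards [h] with q hq
    have := congrFun (mem_annihilator.1 hq) s
    simpa [clif_apply] using this
  have h₂ := (dirDeriv_sum (X := X) Finset.univ fun a => (hv a).mul (hl a).1).2
  refine Eq.trans ?_ (h₂.symm.trans h₁)
  rw [Pi.add_apply, clif_apply, clif_apply, Finset.sum_apply, Finset.sum_apply,
    ← Finset.sum_add_distrib]
  refine Finset.sum_congr rfl fun a _ => Eq.symm ?_
  refine (dirDeriv_mul (hv a) (hl a).1).trans ?_
  rw [(hl a).2]
  simp [mul_comm]

variable [IsManifold (𝓡 (2 * n)) ∞ M]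

/-- The connection coefficient `ω_{ab}^c`. -/
noncomputable def connCoeff (g : Metric n M) (e : Idx n → CField n M) (a b c : Idx n) (p : M) : ℂ :=
  ∑ f, etaInv c f * g.leviCivita (e a) (e b) (e f) p

variable {g : Metric n M} {e : Idx n → CField n M} {U : Set M}

theorem Metric.IsNullFrameOn.omegaUp_antisymm (he : g.IsNullFrameOn e U) (hU : IsOpen U) {p : M}
    (hp : p ∈ U) (a b c : Idx n) : omegaUp g e a b c p = -omegaUp g e a c b p := by
  simp only [omegaUp, ← Finset.sum_neg_distrib]
  rw [Finset.sum_comm]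
  refine Finset.sum_congr rfl fun d _ => Finset.sum_congr rfl fun f _ => ?_
  rw [he.leviCivita_antisymm hU hp]
  ring

theorem sum_eta_mul_omegaUp (a b c : Idx n) (p : M) :
    ∑ d, eta b d * omegaUp g e a d c p = connCoeff g e a b c p := by
  have h : ∀ d, eta b d * omegaUp g e a d c p =
      ∑ d', (eta b d * etaInv d d') * connCoeff g e a d' c p := by
    intro d
    simp only [omegaUp, connCoeff, Finset.mul_sum]
    refine Finset.sum_congr rfl fun d' _ => Finset.sum_congr rfl fun f _ => ?_
    ring
  simp only [h]
  rw [Finset.sum_comm]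
  simp only [← Finset.sum_mul, sum_eta_mul_etaInv]
  simp

/-- This is the compatibility of the spinorial connection with Clifford multiplication. The form `A`
acts by scalars and drops out of the commutator. -/
theorem Metric.IsNullFrameOn.Omega_gam (he : g.IsNullFrameOn e U) (hU : IsOpen U) {p : M}
    (hp : p ∈ U) (A : Idx n → M → ℂ) (a b : Idx n) (ψ : Spinor n) :
    Omega g e A a p (gam b ψ) - gam b (Omega g e A a p ψ) =
      ∑ c, connCoeff g e a b c p • gam c ψ := by
  have h := commutator_sum_gam_gam (fun c d => omegaUp g e a c d p)
    (fun c d => he.omegaUp_antisymm hU hp a c d) b ψ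
  simp only [sum_eta_mul_omegaUp] at h
  have h' := congrArg (fun ψ => (-(1 / 4 : ℂ)) • ψ) h
  simp only [smul_sub, smul_neg, Finset.smul_sum, smul_smul] at h'
  simp only [Omega, LinearMap.add_apply, LinearMap.smul_apply, LinearMap.sum_apply,
    LinearMap.comp_apply, LinearMap.id_apply, map_add, map_smul, map_sum, Finset.smul_sum,
    smul_smul] at h' ⊢
  rw [add_sub_add_right_eq_sub, h', ← Finset.sum_neg_distrib]
  refine Finset.sum_congr rfl fun c _ => ?_
  rw [← neg_smul]
  congr 1
  ring

/-- Apply `Ω_a` to `v · ψ = 0` and commute it past the Clifford product. Together with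
`clif_spinDeriv` this is the Leibniz rule for `∇_a`. -/
theorem Metric.IsNullFrameOn.clif_Omega (he : g.IsNullFrameOn e U) (hU : IsOpen U) {p : M}
    (hp : p ∈ U) (A : Idx n → M → ℂ) (a : Idx n) (v : Idx n → ℂ) {ψ : Spinor n}
    (hv : v ∈ annihilator ψ) :
    clif v (Omega g e A a p ψ) = -clif (fun c => ∑ b, v b * connCoeff g e a b c p) ψ := by
  have h : ∑ b, v b • Omega g e A a p (gam b ψ) = 0 := by
    have := congrArg (Omega g e A a p) (mem_annihilator.1 hv)
    rw [clif_apply, map_sum, map_zero] at this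
    simpa only [map_smul] using this
  have h' : ∀ b, gam b (Omega g e A a p ψ) =
      Omega g e A a p (gam b ψ) - ∑ c, connCoeff g e a b c p • gam c ψ := fun b => by
    rw [← he.Omega_gam hU hp, sub_sub_cancel]
  simp only [clif_apply, h', smul_sub, Finset.sum_sub_distrib, h, zero_sub, Finset.smul_sum,
    Finset.sum_smul, smul_smul]
  rw [Finset.sum_comm]

theorem spinConn_eq (A : Idx n → M → ℂ) (a : Idx n) (φ : M → Spinor n) (p : M) :
    spinConn g e A a φ p = spinDeriv (e a) φ p + Omega g e A a p (φ p) := rfl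

/-- The Leibniz rule for Clifford products, applied to sections of `N_φ`. -/
theorem Metric.IsNullFrameOn.clif_spinConn (he : g.IsNullFrameOn e U) (hU : IsOpen U) {p : M}
    (hp : p ∈ U) (A : Idx n → M → ℂ) (a : Idx n) {φ : M → Spinor n}
    (hφ : ∀ s, MDifferentiableAt (𝓡 (2 * n)) 𝓘(ℝ, ℂ) (fun q => φ q s) p) {v : M → Idx n → ℂ}
    (hv : ∀ a, MDifferentiableAt (𝓡 (2 * n)) 𝓘(ℝ, ℂ) (fun q => v q a) p)
    (h : ∀ᶠ q in nhds p, v q ∈ annihilator (φ q)) :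
    clif (v p) (spinConn g e A a φ p) = -clif (fun c => dirDeriv (e a) (fun q => v q c) p
      + ∑ b, v p b * connCoeff g e a b c p) (φ p) := by
  rw [spinConn_eq, map_add, clif_spinDeriv hφ hv h, he.clif_Omega hU hp A a _ h.self_of_nhds,
    ← neg_add, ← LinearMap.add_apply, ← map_add]
  rfl

/-- Vanishing torsion, written in the frame. -/
theorem Metric.IsNullFrameOn.bracket_frame (he : g.IsNullFrameOn e U) {p : M} (hp : p ∈ U)
    (a b : Idx n) : bracket (e a) (e b) p =
      comb e (fun c => connCoeff g e a b c p - connCoeff g e b a c p) p := by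
  rw [he.eq_comb hp (bracket (e a) (e b))]
  congr 1
  funext c
  simp only [connCoeff, ← Finset.sum_sub_distrib, ← mul_sub, Metric.leviCivita_sub_swap]
  refine Finset.sum_congr rfl fun d _ => ?_
  rw [etaInv_symm c d, mul_comm]

/-- The Clifford product of the bracket of two sections `X`, `Y` of `N_φ` with `φ` is
`X · ∇_Y φ - Y · ∇_X φ`. -/
theorem Metric.IsNullFrameOn.exists_bracket_eq (he : g.IsNullFrameOn e U) (hU : IsOpen U) {p : M}
    (hp : p ∈ U) (A : Idx n → M → ℂ) {φ : M → Spinor n}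
    (hφ : ∀ s, MDifferentiableAt (𝓡 (2 * n)) 𝓘(ℝ, ℂ) (fun q => φ q s) p) {x y : M → Idx n → ℂ}
    (hx : ∀ a, MDifferentiableAt (𝓡 (2 * n)) 𝓘(ℝ, ℂ) (fun q => x q a) p)
    (hy : ∀ a, MDifferentiableAt (𝓡 (2 * n)) 𝓘(ℝ, ℂ) (fun q => y q a) p)
    (hxφ : ∀ᶠ q in nhds p, x q ∈ annihilator (φ q))
    (hyφ : ∀ᶠ q in nhds p, y q ∈ annihilator (φ q)) {X Y : CField n M}
    (hX : ∀ᶠ q in nhds p, X q = comb e (x q) q) (hY : ∀ᶠ q in nhds p, Y q = comb e (y q) q) :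
    ∃ w, bracket X Y p = comb e w p ∧ clif w (φ p) =
      clif (x p) (∑ b, y p b • spinConn g e A b φ p)
        - clif (y p) (∑ b, x p b • spinConn g e A b φ p) := by
  refine ⟨_, bracket_eq_comb (fun a => (he.1 a).diffFieldAt hU hp)
    (fun a b => he.bracket_frame hp a b) hx hy hX hY, ?_⟩
  simp only [map_sum, map_smul, he.clif_spinConn hU hp A _ hφ hx hxφ,
    he.clif_spinConn hU hp A _ hφ hy hyφ]
  have hc : ∀ (c : Idx n → ℂ) (u : Idx n → Idx n → ℂ), ∑ b, c b • -clif (u b) (φ p) =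
      clif (∑ b, -(c b • u b)) (φ p) := fun c u => by
    simp only [map_sum, map_neg, map_smul, LinearMap.sum_apply, LinearMap.neg_apply,
      LinearMap.smul_apply, smul_neg]
  rw [hc, hc, ← LinearMap.sub_apply, ← map_sub]
  congr 2
  funext c
  rw [dirDeriv_comb e _ _ hX.self_of_nhds, dirDeriv_comb e _ _ hY.self_of_nhds]
  simp only [Pi.sub_apply, Finset.sum_apply, Pi.smul_apply, Pi.neg_apply, smul_eq_mul,
    mul_add, Finset.sum_neg_distrib, Finset.sum_add_distrib, Finset.mul_sum, mul_sub,
    Finset.sum_sub_distrib]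
  rw [Finset.sum_comm (f := fun a b => x p a * y p b * connCoeff g e b a c p)]
  simp only [← mul_assoc, mul_comm (y p _) (x p _)]
  ring

end Fields

/-! ### Integrability in terms of spinor derivatives -/

section Fields

variable {n : ℕ} {M : Type*} [TopologicalSpace M]
  [ChartedSpace (EuclideanSpace ℝ (Fin (2 * n))) M]

theorem contMDiffOn_linear {φ : M → Spinor n} {U : Set M}
    (hφ : ContMDiffOn (𝓡 (2 * n)) 𝓘(ℝ, Spinor n) ∞ φ U) (l : Spinor n →ₗ[ℂ] ℂ) :
    ContMDiffOn (𝓡 (2 * n)) 𝓘(ℝ, ℂ) ∞ (fun q => l (φ q)) U :=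
  (LinearMap.toContinuousLinearMap (l.restrictScalars ℝ)).contDiff.contMDiff.comp_contMDiffOn hφ

theorem contMDiffOn_component {φ : M → Spinor n} {U : Set M}
    (hφ : ContMDiffOn (𝓡 (2 * n)) 𝓘(ℝ, Spinor n) ∞ φ U) (s : Finset (Fin n)) :
    ContMDiffOn (𝓡 (2 * n)) 𝓘(ℝ, ℂ) ∞ (fun q => φ q s) U :=
  contMDiffOn_linear hφ (LinearMap.proj s)

theorem mdifferentiableAt_of_contMDiffOn {f : M → ℂ} {U : Set M}
    (hf : ContMDiffOn (𝓡 (2 * n)) 𝓘(ℝ, ℂ) ∞ f U) (hU : IsOpen U) {p : M} (hp : p ∈ U) :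
    MDifferentiableAt (𝓡 (2 * n)) 𝓘(ℝ, ℂ) f p :=
  (hf.contMDiffAt (hU.mem_nhds hp)).mdifferentiableAt (by simp)

theorem contMDiffOn_nullVector {φ : M → Spinor n} {U : Set M}
    (hφ : ContMDiffOn (𝓡 (2 * n)) 𝓘(ℝ, Spinor n) ∞ φ U) (l : Spinor n →ₗ[ℂ] ℂ) (a : Idx n) :
    ContMDiffOn (𝓡 (2 * n)) 𝓘(ℝ, ℂ) ∞ (fun q => nullVector l (φ q) a) U := by
  refine (contMDiffOn_linear hφ (∑ b, etaInv a b • (l ∘ₗ gam b))).congr fun q _ => ?_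
  simp only [nullVector, LinearMap.sum_apply, LinearMap.smul_apply, LinearMap.comp_apply,
    smul_eq_mul]

theorem contMDiffOn_re_im {f : M → ℂ} {U : Set M}
    (hf : ContMDiffOn (𝓡 (2 * n)) 𝓘(ℝ, ℂ) ∞ f U) :
    ContMDiffOn (𝓡 (2 * n)) 𝓘(ℝ, ℝ) ∞ (fun q => (f q).re) U ∧
    ContMDiffOn (𝓡 (2 * n)) 𝓘(ℝ, ℝ) ∞ (fun q => (f q).im) U :=
  ⟨Complex.reCLM.contDiff.contMDiff.comp_contMDiffOn hf,
    Complex.imCLM.contDiff.contMDiff.comp_contMDiffOn hf⟩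

variable [IsManifold (𝓡 (2 * n)) ∞ M] {g : Metric n M} {e : Idx n → CField n M} {U : Set M}
  {φ : M → Spinor n}

theorem SmoothFieldOn.mono {Z : CField n M} {V : Set M} (hZ : SmoothFieldOn Z U) (hV : V ⊆ U) :
    SmoothFieldOn Z V :=
  ⟨ContMDiffOn.mono hZ.1 hV, ContMDiffOn.mono hZ.2 hV⟩

/-- The components of a smooth section of `N_φ`. -/
theorem Metric.IsNullFrameOn.exists_components (he : g.IsNullFrameOn e U) {V : Set M}
    (hV : IsOpen V) (hVU : V ⊆ U) {X : CField n M} (hX : SmoothFieldOn X V)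
    (hXφ : ∀ p ∈ V, TangentAt e φ X p) : ∃ x : M → Idx n → ℂ,
      (∀ p ∈ V, ∀ a, MDifferentiableAt (𝓡 (2 * n)) 𝓘(ℝ, ℂ) (fun q => x q a) p) ∧
      (∀ p ∈ V, X p = comb e (x p) p) ∧ ∀ p ∈ V, x p ∈ annihilator (φ p) := by
  refine ⟨fun p c => ∑ d, g.pair X (e d) p * etaInv d c, fun p hp a => ?_,
    fun p hp => he.eq_comb (hVU hp) X, fun p hp => ?_⟩
  · refine (dirDeriv_sum (X := X) Finset.univ fun d => ?_).1
    exact (mdifferentiableAt_of_contMDiffOn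
      (g.contMDiffOn_pair hX ((he.1 d).mono hVU)) hV hp).mul mdifferentiableAt_const
  · obtain ⟨v, hv, hv'⟩ := hXφ p hp
    have : (fun c => ∑ d, g.pair X (e d) p * etaInv d c) = v :=
      funext fun c => (he.coeff (hVU hp) hv' c).symm
    exact (congrArg (· ∈ annihilator (φ p)) this).mpr hv

/-- The derivative of a pure spinor field is tangent to the cone of pure spinors. -/
theorem Metric.IsNullFrameOn.exists_clif_spinConn (he : g.IsNullFrameOn e U) (hU : IsOpen U)
    (hφ : IsPureFieldOn φ U) (A : Idx n → M → ℂ) {p : M} (hp : p ∈ U) {x : Idx n → ℂ}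
    (hx : x ∈ annihilator (φ p)) (a : Idx n) :
    ∃ v, clif x (spinConn g e A a φ p) = clif v (φ p) := by
  -- The vector `x` is extended to a smooth section of `N_φ`, so that the Leibniz rule applies.
  obtain ⟨l, rfl⟩ := exists_nullVector_eq (hφ.2 p hp).1 hx
  refine ⟨-(fun c => dirDeriv (e a) (fun q => nullVector l (φ q) c) p
      + ∑ b, nullVector l (φ p) b * connCoeff g e a b c p), ?_⟩
  rw [map_neg, LinearMap.neg_apply]
  refine he.clif_spinConn hU hp A a (v := fun q => nullVector l (φ q))
    (fun s => mdifferentiableAt_of_contMDiffOn (contMDiffOn_component hφ.1 s) hU hp)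
    (fun b => mdifferentiableAt_of_contMDiffOn (contMDiffOn_nullVector hφ.1 l b) hU hp) ?_
  filter_upwards [hU.mem_nhds hp] with q hq using (hφ.2 q hq).nullVector_mem l

theorem IsTwistorOn.spinConn_eq {A : Idx n → M → ℂ} (h : IsTwistorOn g e A φ U) {p : M}
    (hp : p ∈ U) (a : Idx n) :
    spinConn g e A a φ p = gam a ((1 / (2 * (n : ℂ))) • dirac g e A φ p) := by
  rw [map_smul]
  exact sub_eq_zero.1 (h a p hp)

theorem IsTwistorOn.sum_spinConn {A : Idx n → M → ℂ} (h : IsTwistorOn g e A φ U) {p : M}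
    (hp : p ∈ U) (y : Idx n → ℂ) : ∑ b, y b • spinConn g e A b φ p =
      clif y ((1 / (2 * (n : ℂ))) • dirac g e A φ p) := by
  rw [clif_apply]
  exact Finset.sum_congr rfl fun b _ => by rw [h.spinConn_eq hp]

/-- Both terms of the bracket formula vanish separately. This sufficient condition serves the
positive result and the integrable counterexample alike. -/
theorem Metric.IsNullFrameOn.isIntegrableOn (he : g.IsNullFrameOn e U) (hU : IsOpen U)
    (hφ : ContMDiffOn (𝓡 (2 * n)) 𝓘(ℝ, Spinor n) ∞ φ U) (A : Idx n → M → ℂ)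
    (h : ∀ p ∈ U, ∀ x ∈ annihilator (φ p), ∀ y ∈ annihilator (φ p),
      clif x (∑ b, y b • spinConn g e A b φ p) = 0) : IsIntegrableOn e φ U := by
  intro V hV hVU X Y hX hY hXφ hYφ p hp
  obtain ⟨x, hx, hXx, hxφ⟩ := he.exists_components hV hVU hX hXφ
  obtain ⟨y, hy, hYy, hyφ⟩ := he.exists_components hV hVU hY hYφ
  have ev : ∀ {P : M → Prop}, (∀ q ∈ V, P q) → ∀ᶠ q in nhds p, P q := fun hP =>
    Filter.mem_of_superset (hV.mem_nhds hp) hP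
  obtain ⟨w, hw, hwφ⟩ := he.exists_bracket_eq hU (hVU hp) A
    (fun s => mdifferentiableAt_of_contMDiffOn (contMDiffOn_component hφ s) hU (hVU hp))
    (hx p hp) (hy p hp) (ev hxφ) (ev hyφ) (ev hXx) (ev hYy)
  refine ⟨w, mem_annihilator.2 ?_, hw⟩
  rw [hwφ, h p (hVU hp) _ (hxφ p hp) _ (hyφ p hp), h p (hVU hp) _ (hyφ p hp) _ (hxφ p hp), sub_zero]

/-- A pure twistor generates an integrable distribution, except in dimension `6`. -/
theorem IsTwistorOn.isIntegrableOn (hn : n = 2 ∨ 4 ≤ n) (hU : IsOpen U)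
    (he : g.IsNullFrameOn e U) (hφ : IsPureFieldOn φ U) {A : Idx n → M → ℂ}
    (h : IsTwistorOn g e A φ U) : IsIntegrableOn e φ U := by
  refine he.isIntegrableOn hU hφ.1 A fun p hp u hu v hv => ?_
  rw [h.sum_spinConn hp]
  refine (hφ.2 p hp).clif_clif_eq_zero hn (fun z hz a => ?_) hu hv
  choose f hf using fun b => he.exists_clif_spinConn hU hφ A hp hz b
  refine ⟨∑ b, a b • f b, ?_⟩
  rw [← h.sum_spinConn hp]
  simp only [map_sum, map_smul, hf, LinearMap.sum_apply, LinearMap.smul_apply]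

theorem smoothFieldOn_comb (he : ∀ a, SmoothFieldOn (e a) U) {x : M → Idx n → ℂ}
    (hx : ∀ a, ContMDiffOn (𝓡 (2 * n)) 𝓘(ℝ, ℂ) ∞ (fun q => x q a) U) :
    SmoothFieldOn (fun q => comb e (x q) q) U :=
  ⟨ContMDiffOn.sum_section (s := Finset.univ) fun a _ =>
    ((contMDiffOn_re_im (hx a)).1.smul_section (he a).1).sub_section
      ((contMDiffOn_re_im (hx a)).2.smul_section (he a).2),
    ContMDiffOn.sum_section (s := Finset.univ) fun a _ =>
      ((contMDiffOn_re_im (hx a)).1.smul_section (he a).2).add_section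
      ((contMDiffOn_re_im (hx a)).2.smul_section (he a).1)⟩

theorem Metric.IsNullFrameOn.eq_of_comb_eq (he : g.IsNullFrameOn e U) {p : M} (hp : p ∈ U)
    {v w : Idx n → ℂ} (h : comb e v p = comb e w p) : v = w := by
  funext c
  rw [he.coeff hp (X := fun q => comb e v q) rfl c, he.coeff hp (X := fun q => comb e v q) h c]

/-- Integrability in terms of the spinorial connection. -/
theorem IsIntegrableOn.clif_sum_spinConn (h : IsIntegrableOn e φ U) (hU : IsOpen U)
    (he : g.IsNullFrameOn e U) (hφ : IsPureFieldOn φ U) (A : Idx n → M → ℂ) {p : M} (hp : p ∈ U)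
    {x y : Idx n → ℂ} (hx : x ∈ annihilator (φ p)) (hy : y ∈ annihilator (φ p)) :
    clif x (∑ b, y b • spinConn g e A b φ p) = clif y (∑ b, x b • spinConn g e A b φ p) := by
  obtain ⟨l, rfl⟩ := exists_nullVector_eq (hφ.2 p hp).1 hx
  obtain ⟨m, rfl⟩ := exists_nullVector_eq (hφ.2 p hp).1 hy
  have ev : ∀ {P : M → Prop}, (∀ q ∈ U, P q) → ∀ᶠ q in nhds p, P q := fun hP =>
    Filter.mem_of_superset (hU.mem_nhds hp) hP
  have hd := fun l a => mdifferentiableAt_of_contMDiffOn (contMDiffOn_nullVector hφ.1 l a) hU hp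
  obtain ⟨w, hw, hwφ⟩ := he.exists_bracket_eq hU hp A
    (fun s => mdifferentiableAt_of_contMDiffOn (contMDiffOn_component hφ.1 s) hU hp)
    (hd l) (hd m) (ev fun q hq => (hφ.2 q hq).nullVector_mem l)
    (ev fun q hq => (hφ.2 q hq).nullVector_mem m)
    -- Both vectors are extended with their functionals held fixed; integrability then applies to
    -- the bracket of these two sections.
    (X := fun q => comb e (nullVector l (φ q)) q) (Y := fun q => comb e (nullVector m (φ q)) q)
    (ev fun q _ => rfl) (ev fun q _ => rfl)
  obtain ⟨v, hv, hv'⟩ := h U hU subset_rfl _ _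
    (smoothFieldOn_comb he.1 fun a => contMDiffOn_nullVector hφ.1 l a)
    (smoothFieldOn_comb he.1 fun a => contMDiffOn_nullVector hφ.1 m a)
    (fun q hq => ⟨_, (hφ.2 q hq).nullVector_mem l, rfl⟩)
    (fun q hq => ⟨_, (hφ.2 q hq).nullVector_mem m, rfl⟩) p hp
  rw [he.eq_of_comb_eq hp (hv'.symm.trans hw), mem_annihilator] at hv
  rwa [hv, eq_comm, sub_eq_zero] at hwφ

end Fields

/-! ### Smoothness of the data and a criterion for twistors -/

section Fields

variable {n : ℕ} {M : Type*} [TopologicalSpace M]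
  [ChartedSpace (EuclideanSpace ℝ (Fin (2 * n))) M] {U : Set M}

theorem contMDiffOn_sum {ι : Type*} (s : Finset ι) {f : ι → M → ℂ}
    (hf : ∀ i, ContMDiffOn (𝓡 (2 * n)) 𝓘(ℝ, ℂ) ∞ (f i) U) :
    ContMDiffOn (𝓡 (2 * n)) 𝓘(ℝ, ℂ) ∞ (fun q => ∑ i ∈ s, f i q) U := by
  classical
  induction s using Finset.induction_on with
  | empty => simpa using contMDiffOn_const
  | insert i s hi ih =>
    simp only [Finset.sum_insert hi]
    exact (hf i).add ih

theorem contMDiffOn_conj {f : M → ℂ} (hf : ContMDiffOn (𝓡 (2 * n)) 𝓘(ℝ, ℂ) ∞ f U) :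
    ContMDiffOn (𝓡 (2 * n)) 𝓘(ℝ, ℂ) ∞ (fun q => (starRingEnd ℂ) (f q)) U :=
  Complex.conjCLE.contDiff.contMDiff.comp_contMDiffOn hf

theorem contMDiffOn_inv {f : M → ℂ} (hf : ContMDiffOn (𝓡 (2 * n)) 𝓘(ℝ, ℂ) ∞ f U)
    (h : ∀ p ∈ U, f p ≠ 0) : ContMDiffOn (𝓡 (2 * n)) 𝓘(ℝ, ℂ) ∞ (fun q => (f q)⁻¹) U :=
  fun p hp => (contDiffAt_inv ℝ (h p hp)).contMDiffAt.comp_contMDiffWithinAt p (hf p hp)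

/-- A nowhere vanishing smooth spinor field has a smooth dual field. -/
theorem exists_dual_spinor {φ : M → Spinor n}
    (hφ : ContMDiffOn (𝓡 (2 * n)) 𝓘(ℝ, Spinor n) ∞ φ U)
    (h₀ : ∀ p ∈ U, φ p ≠ 0) : ∃ ψ : M → Spinor n,
      (∀ s, ContMDiffOn (𝓡 (2 * n)) 𝓘(ℝ, ℂ) ∞ (fun q => ψ q s) U) ∧
      ∀ p ∈ U, ∑ s, ψ p s * φ p s = 1 := by
  -- The dual spinor is the conjugate of `φ` divided by its squared Hermitian norm, which vanishes
  -- only where `φ` does.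
  have hN : ∀ p ∈ U, ∑ t, φ p t * (starRingEnd ℂ) (φ p t) ≠ 0 := by
    intro p hp h
    refine h₀ p hp (funext fun s => ?_)
    simp only [Complex.mul_conj] at h
    rw [← Complex.ofReal_sum, Complex.ofReal_eq_zero,
      Finset.sum_eq_zero_iff_of_nonneg fun t _ => Complex.normSq_nonneg _] at h
    exact Complex.normSq_eq_zero.1 (h s (Finset.mem_univ s))
  refine ⟨fun p s => (starRingEnd ℂ) (φ p s) * (∑ t, φ p t * (starRingEnd ℂ) (φ p t))⁻¹,
    fun s => ?_, fun p hp => ?_⟩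
  · exact contMDiffOn_mul (contMDiffOn_conj (contMDiffOn_component hφ s))
      (contMDiffOn_inv (contMDiffOn_sum _ fun t => contMDiffOn_mul (contMDiffOn_component hφ t)
        (contMDiffOn_conj (contMDiffOn_component hφ t))) hN)
  · rw [← mul_inv_cancel₀ (hN p hp), Finset.sum_mul]
    exact Finset.sum_congr rfl fun s _ => by ring

variable [IsManifold (𝓡 (2 * n)) ∞ M]

theorem contMDiffOn_dirDeriv (hU : IsOpen U) {X : CField n M} (hX : SmoothFieldOn X U) {f : M → ℂ}
    (hf : ContMDiffOn (𝓡 (2 * n)) 𝓘(ℝ, ℂ) ∞ f U) :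
    ContMDiffOn (𝓡 (2 * n)) 𝓘(ℝ, ℂ) ∞ (dirDeriv X f) U := by
  have key : ∀ {V : Π q : M, TangentSpace (𝓡 (2 * n)) q},
      ContMDiffOn (𝓡 (2 * n)) (𝓡 (2 * n)).tangent ∞
        (fun p => (⟨p, V p⟩ : TangentBundle (𝓡 (2 * n)) M)) U →
      ContMDiffOn (𝓡 (2 * n)) 𝓘(ℝ, ℂ) ∞ (fun p => mder f p (V p)) U := by
    intro V hV
    have h₁ := hf.contMDiffOn_tangentMapWithin (m := ∞) (by simp) hU.uniqueMDiffOn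
    have h₂ := h₁.comp hV (fun q hq => hq)
    have h₃ := (contMDiff_snd_tangentBundle_modelSpace (n := ∞) ℂ 𝓘(ℝ, ℂ)).comp_contMDiffOn h₂
    refine h₃.congr fun q hq => ?_
    have := mfderivWithin_of_isOpen (I := 𝓡 (2 * n)) (I' := 𝓘(ℝ, ℂ)) (f := f) hU hq
    exact congrArg (fun L : TangentSpace (𝓡 (2 * n)) q →L[ℝ] ℂ => L (V q)) this.symm
  exact (key hX.1).add (contMDiffOn_mul (contMDiffOn_const (c := Complex.I)) (key hX.2))

theorem smoothFieldOn_bracket (hU : IsOpen U) {X Y : CField n M} (hX : SmoothFieldOn X U)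
    (hY : SmoothFieldOn Y U) : SmoothFieldOn (bracket X Y) U := by
  have : IsManifold (𝓡 (2 * n)) (((⊤ : ℕ∞) : ℕ∞ω) + 1) M :=
    IsManifold.of_le (n := ∞) (by simp)
  have : IsManifold (𝓡 (2 * n)) (minSmoothness ℝ 2) M := by
    rw [minSmoothness_of_isRCLikeNormedField]; infer_instance
  have key : ∀ {V W : Π q : M, TangentSpace (𝓡 (2 * n)) q},
      ContMDiffOn (𝓡 (2 * n)) (𝓡 (2 * n)).tangent ∞
        (fun p => (⟨p, V p⟩ : TangentBundle (𝓡 (2 * n)) M)) U →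
      ContMDiffOn (𝓡 (2 * n)) (𝓡 (2 * n)).tangent ∞
        (fun p => (⟨p, W p⟩ : TangentBundle (𝓡 (2 * n)) M)) U →
      ContMDiffOn (𝓡 (2 * n)) (𝓡 (2 * n)).tangent ∞ (fun p =>
        (⟨p, VectorField.mlieBracket (𝓡 (2 * n)) V W p⟩ : TangentBundle (𝓡 (2 * n)) M)) U := by
    intro V W hV hW p hp
    exact (ContMDiffAt.mlieBracket_vectorField (m := ⊤) (n := ⊤) (hV.contMDiffAt (hU.mem_nhds hp))
      (hW.contMDiffAt (hU.mem_nhds hp)) (by simp)).contMDiffWithinAt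
  exact ⟨(key hX.1 hY.1).sub_section (key hX.2 hY.2), (key hX.1 hY.2).add_section (key hX.2 hY.1)⟩

variable {g : Metric n M} {e : Idx n → CField n M} {φ : M → Spinor n}

theorem Metric.contMDiffOn_leviCivita (hU : IsOpen U) {X Y Z : CField n M}
    (hX : SmoothFieldOn X U) (hY : SmoothFieldOn Y U) (hZ : SmoothFieldOn Z U) :
    ContMDiffOn (𝓡 (2 * n)) 𝓘(ℝ, ℂ) ∞ (g.leviCivita X Y Z) U := by
  refine contMDiffOn_mul contMDiffOn_const ?_
  exact (((((contMDiffOn_dirDeriv hU hX (g.contMDiffOn_pair hY hZ)).add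
    (contMDiffOn_dirDeriv hU hY (g.contMDiffOn_pair hX hZ))).sub
    (contMDiffOn_dirDeriv hU hZ (g.contMDiffOn_pair hX hY))).add
    (g.contMDiffOn_pair (smoothFieldOn_bracket hU hX hY) hZ)).sub
    (g.contMDiffOn_pair (smoothFieldOn_bracket hU hX hZ) hY)).sub
    (g.contMDiffOn_pair (smoothFieldOn_bracket hU hY hZ) hX)

theorem Metric.IsNullFrameOn.contMDiffOn_spinConn (he : g.IsNullFrameOn e U) (hU : IsOpen U)
    (hφ : ContMDiffOn (𝓡 (2 * n)) 𝓘(ℝ, Spinor n) ∞ φ U) {A : Idx n → M → ℂ} (hA : IsFormOn A U)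
    (a : Idx n) (s : Finset (Fin n)) :
    ContMDiffOn (𝓡 (2 * n)) 𝓘(ℝ, ℂ) ∞ (fun q => spinConn g e A a φ q s) U := by
  have hω : ∀ b c, ContMDiffOn (𝓡 (2 * n)) 𝓘(ℝ, ℂ) ∞ (omegaUp g e a b c) U := fun b c =>
    contMDiffOn_sum _ fun d => contMDiffOn_sum _ fun f => contMDiffOn_mul contMDiffOn_const
      (Metric.contMDiffOn_leviCivita hU (he.1 a) (he.1 d) (he.1 f))
  have h : (fun q => spinConn g e A a φ q s) = fun q => dirDeriv (e a) (fun q => φ q s) q +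
      (-(1 / 4 : ℂ) * (∑ b, ∑ c, omegaUp g e a b c q *
        (LinearMap.proj s ∘ₗ gam b ∘ₗ gam c) (φ q)) + A a q * φ q s) := by
    funext q
    simp [spinConn, Omega, Finset.sum_apply, -Fintype.sum_sum_type]
  rw [h]
  exact (contMDiffOn_dirDeriv hU (he.1 a) (contMDiffOn_component hφ s)).add
    ((contMDiffOn_mul contMDiffOn_const (contMDiffOn_sum _ fun b => contMDiffOn_sum _ fun c =>
      contMDiffOn_mul (hω b c) (contMDiffOn_linear hφ _))).add
    (contMDiffOn_mul (hA a) (contMDiffOn_component hφ s)))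

/-- Since `A` enters as a scalar term, derivatives can be computed with `A = 0` and the form chosen
afterwards. -/
theorem spinConn_eq_add (A : Idx n → M → ℂ) (a : Idx n) (p : M) :
    spinConn g e A a φ p = spinConn g e 0 a φ p + A a p • φ p := by
  simp [spinConn, Omega, add_assoc]

/-- The twistor equation holds if all the derivatives `∇_a φ` are of the form `e_a · χ`. -/
theorem twistorOp_eq_zero [NeZero n] {A : Idx n → M → ℂ} {p : M} {χ : Spinor n}
    (h : ∀ a, spinConn g e A a φ p = gam a χ) (a : Idx n) : twistorOp g e A a φ p = 0 := by
  have hn : (n : ℂ) ≠ 0 := NeZero.ne _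
  -- This is `g^{ab} e_a e_b = 2n`: each pair `e_i`, `θ^i` contributes `2`.
  have hd : dirac g e A φ p = (2 * (n : ℂ)) • χ := by
    have hsum : ∀ i : Fin n, (2 : ℂ) • contract i (wedge i χ) + (2 : ℂ) • wedge i (contract i χ)
        = (2 : ℂ) • χ := fun i => by
      rw [← smul_add, contract_wedge_add]
      simp
    simp only [dirac, h, Fintype.sum_sum_type, gam, etaInv, Matrix.fromBlocks_apply₁₁,
      Matrix.fromBlocks_apply₁₂, Matrix.fromBlocks_apply₂₁, Matrix.fromBlocks_apply₂₂,
      Matrix.zero_apply, zero_smul, Finset.sum_const_zero, zero_add, add_zero, Matrix.smul_apply,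
      Matrix.one_apply, Sum.elim_inl, Sum.elim_inr, smul_eq_mul, mul_ite, mul_one, mul_zero,
      ite_smul, Finset.sum_ite_eq, Finset.mem_univ, if_true]
    rw [← Finset.sum_add_distrib, Finset.sum_congr rfl fun i _ => hsum i]
    simp only [Finset.sum_const, Finset.card_univ, Fintype.card_fin, ← Nat.cast_smul_eq_nsmul ℂ,
      smul_smul]
    rw [mul_comm]
  rw [twistorOp, hd, h, map_smul, smul_smul]
  have : 1 / (2 * (n : ℂ)) * (2 * n) = 1 := by field_simp
  rw [this, one_smul, sub_self]

end Fields

/-! ### The converse in dimension 4 -/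

section FourDim

theorem contract_zero_two (φ : Spinor 2) : contract 0 φ ∅ = φ {0} ∧ contract 0 φ {0} = 0 ∧
    contract 0 φ {1} = φ {0, 1} ∧ contract 0 φ {0, 1} = 0 := by
  refine ⟨?_, ?_, ?_, ?_⟩ <;> simp [contract_apply, wedgeSign, Finset.filter_singleton]

theorem contract_one_two (φ : Spinor 2) : contract 1 φ ∅ = φ {1} ∧ contract 1 φ {0} = -φ {0, 1} ∧
    contract 1 φ {1} = 0 ∧ contract 1 φ {0, 1} = 0 := by
  refine ⟨?_, ?_, ?_, ?_⟩ <;>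
    simp [contract_apply, wedgeSign, Finset.filter_singleton, Finset.pair_comm]

theorem wedge_zero_two (φ : Spinor 2) : wedge 0 φ ∅ = 0 ∧ wedge 0 φ {0} = φ ∅ ∧
    wedge 0 φ {1} = 0 ∧ wedge 0 φ {0, 1} = φ {1} := by
  have h : ({0, 1} : Finset (Fin 2)).erase 0 = {1} := by decide
  refine ⟨?_, ?_, ?_, ?_⟩ <;> simp [wedge_apply, wedgeSign, Finset.filter_singleton, h]

theorem wedge_one_two (φ : Spinor 2) : wedge 1 φ ∅ = 0 ∧ wedge 1 φ {0} = 0 ∧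
    wedge 1 φ {1} = φ ∅ ∧ wedge 1 φ {0, 1} = -φ {0} := by
  have h : ({0, 1} : Finset (Fin 2)).erase 1 = {0} := by decide
  refine ⟨?_, ?_, ?_, ?_⟩ <;> simp [wedge_apply, wedgeSign, h, Finset.filter_insert,
    Finset.filter_singleton]

theorem sum_finset_two (f : Finset (Fin 2) → ℂ) :
    ∑ s, f s = f ∅ + f {0} + f {1} + f {0, 1} := by
  have h : (Finset.univ : Finset (Finset (Fin 2))) = {∅, {0}, {1}, {0, 1}} := by decide
  rw [h, Finset.sum_insert (by decide), Finset.sum_insert (by decide),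
    Finset.sum_insert (by decide), Finset.sum_singleton]
  ring

theorem spinor_two_ext {φ ψ : Spinor 2} (h₀ : φ ∅ = ψ ∅) (h₁ : φ {0} = ψ {0}) (h₂ : φ {1} = ψ {1})
    (h₃ : φ {0, 1} = ψ {0, 1}) : φ = ψ := by
  funext s
  have h : ∀ s : Finset (Fin 2), s = ∅ ∨ s = {0} ∨ s = {1} ∨ s = {0, 1} := by decide
  rcases h s with rfl | rfl | rfl | rfl <;> assumption

theorem clif_two (v : Idx 2 → ℂ) (φ : Spinor 2) : clif v φ =
    v (Sum.inl 0) • contract 0 φ + v (Sum.inl 1) • contract 1 φ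
      + (v (Sum.inr 0) • wedge 0 φ + v (Sum.inr 1) • wedge 1 φ) := by
  simp [clif_apply, gam]

/-- Pure spinors are even or odd in dimension `4`. -/
theorem IsPure.mul_eq_zero_two {φ : Spinor 2} (hφ : IsPure φ) :
    φ {0} * φ ∅ = 0 ∧ φ {1} * φ ∅ = 0 ∧ φ {0} * φ {0, 1} = 0 ∧ φ {1} * φ {0, 1} = 0 := by
  -- The null vectors built from `φ` are quadratic relations: each kills `φ`, and for the
  -- functionals `∅` and `{0, 1}` the odd components give the four products.
  have h : ∀ s t, clif (nullVector (LinearMap.proj s) φ) φ t = 0 := fun s t => by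
    rw [mem_annihilator.1 (hφ.nullVector_mem _), Pi.zero_apply]
  have h₁ := h ∅ {0}
  have h₂ := h ∅ {1}
  have h₃ := h {0, 1} {0}
  have h₄ := h {0, 1} {1}
  simp [clif_two, nullVector, etaInv, gam, Matrix.one_apply, contract_zero_two, contract_one_two,
    wedge_zero_two, wedge_one_two] at h₁ h₂ h₃ h₄
  simp only [mul_eq_zero]
  tauto

/-- The spinor with the given components. -/
noncomputable def spinorTwo (a b c d : ℂ) : Spinor 2 :=
  fun s => if s = ∅ then a else if s = {0} then b else if s = {1} then c else d

theorem spinorTwo_apply (a b c d : ℂ) : spinorTwo a b c d ∅ = a ∧ spinorTwo a b c d {0} = b ∧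
    spinorTwo a b c d {1} = c ∧ spinorTwo a b c d {0, 1} = d := by
  have h₁ : ({1} : Finset (Fin 2)) ≠ {0} := by decide
  have h₂ : ({0, 1} : Finset (Fin 2)) ≠ {0} := by decide
  have h₃ : ({0, 1} : Finset (Fin 2)) ≠ {1} := by decide
  refine ⟨?_, ?_, ?_, ?_⟩ <;> simp [spinorTwo, h₁, h₂, h₃]

/-- The solution `χ` of the equations `D_a + A_a φ = e_a · χ` in dimension `4`. -/
noncomputable def twistorSolution (φ ψ : Spinor 2) (D : Idx 2 → Spinor 2) : Spinor 2 :=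
  spinorTwo
    (ψ {1} * (φ {1} * D (Sum.inr 0) {0} - φ {0} * D (Sum.inr 0) {1})
      - ψ {0} * (φ {1} * D (Sum.inr 1) {0} - φ {0} * D (Sum.inr 1) {1}))
    (ψ {0, 1} * (φ {0, 1} * D (Sum.inl 0) ∅ - φ ∅ * D (Sum.inl 0) {0, 1})
      + ψ ∅ * (φ {0, 1} * D (Sum.inr 1) ∅ - φ ∅ * D (Sum.inr 1) {0, 1}))
    (ψ {0, 1} * (φ {0, 1} * D (Sum.inl 1) ∅ - φ ∅ * D (Sum.inl 1) {0, 1})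
      - ψ ∅ * (φ {0, 1} * D (Sum.inr 0) ∅ - φ ∅ * D (Sum.inr 0) {0, 1}))
    (-ψ {0} * (φ {1} * D (Sum.inl 0) {0} - φ {0} * D (Sum.inl 0) {1})
      - ψ {1} * (φ {1} * D (Sum.inl 1) {0} - φ {0} * D (Sum.inl 1) {1}))

/-- The solution `A` of the equations `D_a + A_a φ = e_a · χ` in dimension `4`. -/
noncomputable def formSolution (φ ψ : Spinor 2) (D : Idx 2 → Spinor 2) (a : Idx 2) : ℂ :=
  ∑ s, ψ s * (gam a (twistorSolution φ ψ D) s - D a s)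

/-- A pair `(P, Q)` parallel to `(f, h)` is a multiple of it, and the dual pair `(u, v)` reads off
the factor. -/
theorem eq_of_cross {f h P Q u v : ℂ} (hn : u * f + v * h = 1) (hc : h * P = f * Q) :
    (u * P + v * Q) * f = P ∧ (u * P + v * Q) * h = Q :=
  ⟨by linear_combination P * hn - v * hc, by linear_combination Q * hn + u * hc⟩

/-- Within the chirality of `φ`, the equation for `a` is solvable for `A_a` exactly when `e_a · χ -
D_a` is parallel to `φ`. This cross-product condition gives two equations for each unknown component
of `χ`, with the components of `φ` as coefficients up to sign. The dual spinor combines them into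
one value, and `hint` for a basis of `N_φ` makes the two equations agree. The formulas for the other
two components of `χ` vanish identically, so one expression covers both chiralities and its
smoothness needs no case distinction over the domain. -/
theorem formSolution_spec {φ ψ : Spinor 2} {D : Idx 2 → Spinor 2} (hψ : ∑ s, ψ s * φ s = 1)
    (hpar : (φ {0} = 0 ∧ φ {1} = 0 ∧ ∀ a, D a {0} = 0 ∧ D a {1} = 0) ∨
      (φ ∅ = 0 ∧ φ {0, 1} = 0 ∧ ∀ a, D a ∅ = 0 ∧ D a {0, 1} = 0))
    (hint : ∀ x ∈ annihilator φ, ∀ y ∈ annihilator φ,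
      clif x (∑ b, y b • D b) = clif y (∑ b, x b • D b)) (a : Idx 2) :
    D a + formSolution φ ψ D a • φ = gam a (twistorSolution φ ψ D) := by
  rw [sum_finset_two] at hψ
  obtain ⟨c₀, c₁, c₂, c₃⟩ : twistorSolution φ ψ D ∅ = _ ∧ twistorSolution φ ψ D {0} = _ ∧
      twistorSolution φ ψ D {1} = _ ∧ twistorSolution φ ψ D {0, 1} = _ :=
    spinorTwo_apply _ _ _ _
  generalize hχ : twistorSolution φ ψ D = χ at c₀ c₁ c₂ c₃ ⊢
  rcases hpar with ⟨h₀, h₁, hD⟩ | ⟨h₀, h₁, hD⟩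
  -- For even `φ`, the vectors `φ_∅ e_0 - φ_{01} θ^1` and `φ_∅ e_1 + φ_{01} θ^0` span `N_φ`.
  · let x : Idx 2 → ℂ := Sum.elim ![φ ∅, 0] ![0, -φ {0, 1}]
    let y : Idx 2 → ℂ := Sum.elim ![0, φ ∅] ![φ {0, 1}, 0]
    have hx : x ∈ annihilator φ := by
      rw [mem_annihilator, clif_two]
      apply spinor_two_ext <;> simp [x, contract_zero_two, wedge_one_two, h₀]
      ring
    have hy : y ∈ annihilator φ := by
      rw [mem_annihilator, clif_two]
      apply spinor_two_ext <;> simp [y, contract_one_two, wedge_zero_two, h₁]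
      ring
    have hxy := hint x hx y hy
    have e₀ := congrFun hxy {0}
    have e₁ := congrFun hxy {1}
    simp [clif_two, x, y, contract_zero_two, contract_one_two, wedge_zero_two, wedge_one_two]
      at e₀ e₁
    have hn : ψ ∅ * φ ∅ + ψ {0, 1} * φ {0, 1} = 1 := by
      rw [← hψ, h₀, h₁]; ring
    -- The two components of the symmetry condition are the compatibility conditions for `χ {0}` and
    -- `χ {1}`.
    have hw₀ : φ ∅ * (φ {0, 1} * D (Sum.inl 0) ∅ - φ ∅ * D (Sum.inl 0) {0, 1})
      - φ {0, 1} * (φ {0, 1} * D (Sum.inr 1) ∅ - φ ∅ * D (Sum.inr 1) {0, 1}) = 0 := by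
      linear_combination -e₀
    have hw₁ : φ ∅ * (φ {0, 1} * D (Sum.inl 1) ∅ - φ ∅ * D (Sum.inl 1) {0, 1})
      + φ {0, 1} * (φ {0, 1} * D (Sum.inr 0) ∅ - φ ∅ * D (Sum.inr 0) {0, 1}) = 0 := by
      linear_combination -e₁
    have hz : ∀ a, gam a χ {0} = 0 ∧ gam a χ {1} = 0 := by
      rintro (i | i) <;> fin_cases i <;> simp [gam, contract_zero_two, contract_one_two,
        wedge_zero_two, wedge_one_two, c₀, c₃, h₀, h₁]
    have hc : ∀ a, φ {0, 1} * (gam a χ ∅ - D a ∅) = φ ∅ * (gam a χ {0, 1} - D a {0, 1}) := by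
      rintro (i | i) <;> fin_cases i <;> simp only [gam, Sum.elim_inl, Sum.elim_inr,
        Fin.zero_eta, Fin.mk_one, Fin.isValue, contract_zero_two, contract_one_two,
        wedge_zero_two, wedge_one_two]
      · linear_combination φ {0, 1} * c₁ + (φ {0, 1} * D (Sum.inl 0) ∅
        - φ ∅ * D (Sum.inl 0) {0, 1}) * hn - ψ ∅ * hw₀
      · linear_combination φ {0, 1} * c₂ + (φ {0, 1} * D (Sum.inl 1) ∅
        - φ ∅ * D (Sum.inl 1) {0, 1}) * hn - ψ ∅ * hw₁
      · linear_combination -φ ∅ * c₂ + (φ {0, 1} * D (Sum.inr 0) ∅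
        - φ ∅ * D (Sum.inr 0) {0, 1}) * hn - ψ {0, 1} * hw₁
      · linear_combination φ ∅ * c₁ + (φ {0, 1} * D (Sum.inr 1) ∅
        - φ ∅ * D (Sum.inr 1) {0, 1}) * hn + ψ {0, 1} * hw₀
    have hA : formSolution φ ψ D a =
        ψ ∅ * (gam a χ ∅ - D a ∅) + ψ {0, 1} * (gam a χ {0, 1} - D a {0, 1}) := by
      rw [formSolution, sum_finset_two, hχ, (hz a).1, (hz a).2, (hD a).1, (hD a).2]
      ring
    obtain ⟨k₁, k₂⟩ := eq_of_cross hn (hc a)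
    rw [← hA] at k₁ k₂
    apply spinor_two_ext <;> simp only [Pi.add_apply, Pi.smul_apply, smul_eq_mul]
    · linear_combination k₁
    · rw [(hD a).1, (hz a).1, h₀]; ring
    · rw [(hD a).2, (hz a).2, h₁]; ring
    · linear_combination k₂
  -- For odd `φ`, `N_φ` is spanned by one combination of the `e_i` and one of the `θ^i`.
  · let x : Idx 2 → ℂ := Sum.elim ![φ {1}, -φ {0}] ![0, 0]
    let y : Idx 2 → ℂ := Sum.elim ![0, 0] ![φ {0}, φ {1}]
    have hx : x ∈ annihilator φ := by
      rw [mem_annihilator, clif_two]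
      apply spinor_two_ext <;> simp [x, contract_zero_two, contract_one_two, h₁]
      ring
    have hy : y ∈ annihilator φ := by
      rw [mem_annihilator, clif_two]
      apply spinor_two_ext <;> simp [y, wedge_zero_two, wedge_one_two, h₀]
      ring
    have hxy := hint x hx y hy
    have e₀ := congrFun hxy ∅
    have e₁ := congrFun hxy {0, 1}
    simp [clif_two, x, y, contract_zero_two, contract_one_two, wedge_zero_two, wedge_one_two]
      at e₀ e₁
    have hn : ψ {0} * φ {0} + ψ {1} * φ {1} = 1 := by
      rw [← hψ, h₀, h₁]; ring
    have hw₀ : φ {0} * (φ {1} * D (Sum.inr 0) {0} - φ {0} * D (Sum.inr 0) {1})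
      + φ {1} * (φ {1} * D (Sum.inr 1) {0} - φ {0} * D (Sum.inr 1) {1}) = 0 := by
      linear_combination e₀
    have hw₁ : φ {1} * (φ {1} * D (Sum.inl 0) {0} - φ {0} * D (Sum.inl 0) {1})
      - φ {0} * (φ {1} * D (Sum.inl 1) {0} - φ {0} * D (Sum.inl 1) {1}) = 0 := by
      linear_combination e₁
    have hz : ∀ a, gam a χ ∅ = 0 ∧ gam a χ {0, 1} = 0 := by
      rintro (i | i) <;> fin_cases i <;> simp [gam, contract_zero_two, contract_one_two,
        wedge_zero_two, wedge_one_two, c₁, c₂, h₀, h₁]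
    have hc : ∀ a, φ {1} * (gam a χ {0} - D a {0}) = φ {0} * (gam a χ {1} - D a {1}) := by
      rintro (i | i) <;> fin_cases i <;> simp only [gam, Sum.elim_inl, Sum.elim_inr,
        Fin.zero_eta, Fin.mk_one, Fin.isValue, contract_zero_two, contract_one_two,
        wedge_zero_two, wedge_one_two]
      · linear_combination -φ {0} * c₃ + (φ {1} * D (Sum.inl 0) {0}
        - φ {0} * D (Sum.inl 0) {1}) * hn - ψ {1} * hw₁
      · linear_combination -φ {1} * c₃ + (φ {1} * D (Sum.inl 1) {0}
        - φ {0} * D (Sum.inl 1) {1}) * hn + ψ {0} * hw₁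
      · linear_combination φ {1} * c₀ + (φ {1} * D (Sum.inr 0) {0}
        - φ {0} * D (Sum.inr 0) {1}) * hn - ψ {0} * hw₀
      · linear_combination -φ {0} * c₀ + (φ {1} * D (Sum.inr 1) {0}
        - φ {0} * D (Sum.inr 1) {1}) * hn - ψ {1} * hw₀
    have hA : formSolution φ ψ D a =
        ψ {0} * (gam a χ {0} - D a {0}) + ψ {1} * (gam a χ {1} - D a {1}) := by
      rw [formSolution, sum_finset_two, hχ, (hz a).1, (hz a).2, (hD a).1, (hD a).2]
      ring
    obtain ⟨k₁, k₂⟩ := eq_of_cross hn (hc a)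
    rw [← hA] at k₁ k₂
    apply spinor_two_ext <;> simp only [Pi.add_apply, Pi.smul_apply, smul_eq_mul]
    · rw [(hD a).1, (hz a).1, h₀]; ring
    · linear_combination k₁
    · linear_combination k₂
    · rw [(hD a).2, (hz a).2, h₁]; ring

theorem gam_gam_two_even (b c : Idx 2) {φ : Spinor 2} (h₀ : φ {0} = 0) (h₁ : φ {1} = 0) :
    gam b (gam c φ) {0} = 0 ∧ gam b (gam c φ) {1} = 0 := by
  rcases b with i | i <;> rcases c with j | j <;> fin_cases i <;> fin_cases j <;>
    simp [gam, contract_zero_two, contract_one_two, wedge_zero_two, wedge_one_two, h₀, h₁]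

theorem gam_gam_two_odd (b c : Idx 2) {φ : Spinor 2} (h₀ : φ ∅ = 0) (h₁ : φ {0, 1} = 0) :
    gam b (gam c φ) ∅ = 0 ∧ gam b (gam c φ) {0, 1} = 0 := by
  rcases b with i | i <;> rcases c with j | j <;> fin_cases i <;> fin_cases j <;>
    simp [gam, contract_zero_two, contract_one_two, wedge_zero_two, wedge_one_two, h₀, h₁]

variable {M : Type*} [TopologicalSpace M] [ChartedSpace (EuclideanSpace ℝ (Fin (2 * 2))) M]
  {U : Set M} {φ : M → Spinor 2}

theorem contMDiffOn_formSolution {ψ : M → Spinor 2} {D : Idx 2 → M → Spinor 2}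
    (hφ : ∀ s, ContMDiffOn (𝓡 (2 * 2)) 𝓘(ℝ, ℂ) ∞ (fun q => φ q s) U)
    (hψ : ∀ s, ContMDiffOn (𝓡 (2 * 2)) 𝓘(ℝ, ℂ) ∞ (fun q => ψ q s) U)
    (hD : ∀ a s, ContMDiffOn (𝓡 (2 * 2)) 𝓘(ℝ, ℂ) ∞ (fun q => D a q s) U) (a : Idx 2) :
    ContMDiffOn (𝓡 (2 * 2)) 𝓘(ℝ, ℂ) ∞
      (fun q => formSolution (φ q) (ψ q) (fun b => D b q) a) U := by
  have hw : ∀ s t b, ContMDiffOn (𝓡 (2 * 2)) 𝓘(ℝ, ℂ) ∞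
      (fun q => φ q s * D b q t - φ q t * D b q s) U := fun s t b =>
    (contMDiffOn_mul (hφ s) (hD b t)).sub (contMDiffOn_mul (hφ t) (hD b s))
  have hχ : ContMDiffOn (𝓡 (2 * 2)) 𝓘(ℝ, Spinor 2) ∞
      (fun q => twistorSolution (φ q) (ψ q) (fun b => D b q)) U := by
    refine contMDiffOn_pi_space.2 fun s => ?_
    unfold twistorSolution spinorTwo
    split_ifs
    · exact (contMDiffOn_mul (hψ _) (hw _ _ _)).sub (contMDiffOn_mul (hψ _) (hw _ _ _))
    · exact (contMDiffOn_mul (hψ _) (hw _ _ _)).add (contMDiffOn_mul (hψ _) (hw _ _ _))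
    · exact (contMDiffOn_mul (hψ _) (hw _ _ _)).sub (contMDiffOn_mul (hψ _) (hw _ _ _))
    · exact (contMDiffOn_mul (hψ _).neg (hw _ _ _)).sub (contMDiffOn_mul (hψ _) (hw _ _ _))
  exact contMDiffOn_sum _ fun s => contMDiffOn_mul (hψ s)
    ((contMDiffOn_linear hχ (LinearMap.proj s ∘ₗ gam a)).sub (hD a s))

variable [IsManifold (𝓡 (2 * 2)) ∞ M] {g : Metric 2 M} {e : Idx 2 → CField 2 M}

/-- Differentiating a pure spinor field preserves its chirality in dimension `4`. -/
theorem spinConn_parity_two (hU : IsOpen U) (hφ : IsPureFieldOn φ U) {p : M} (hp : p ∈ U) :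
    (φ p {0} = 0 ∧ φ p {1} = 0 ∧
      ∀ a, spinConn g e 0 a φ p {0} = 0 ∧ spinConn g e 0 a φ p {1} = 0) ∨
    (φ p ∅ = 0 ∧ φ p {0, 1} = 0 ∧
      ∀ a, spinConn g e 0 a φ p ∅ = 0 ∧ spinConn g e 0 a φ p {0, 1} = 0) := by
  have hd : ∀ s t, (∀ q ∈ U, φ q s * φ q t = 0) → ∀ X : CField 2 M,
      φ p s * dirDeriv X (fun q => φ q t) p + φ p t * dirDeriv X (fun q => φ q s) p = 0 := by
    intro s t h X
    have hm := fun s => mdifferentiableAt_of_contMDiffOn (contMDiffOn_component hφ.1 s) hU hp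
    rw [← dirDeriv_mul (hm s) (hm t), dirDeriv_congr (g := fun _ => 0), dirDeriv_const]
    filter_upwards [hU.mem_nhds hp] with q hq using h q hq
  have d₁ := hd {0} ∅ fun q hq => (hφ.2 q hq).mul_eq_zero_two.1
  have d₂ := hd {1} ∅ fun q hq => (hφ.2 q hq).mul_eq_zero_two.2.1
  have d₃ := hd {0} {0, 1} fun q hq => (hφ.2 q hq).mul_eq_zero_two.2.2.1
  have d₄ := hd {1} {0, 1} fun q hq => (hφ.2 q hq).mul_eq_zero_two.2.2.2
  obtain ⟨m₁, m₂, m₃, m₄⟩ := (hφ.2 p hp).mul_eq_zero_two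
  have hs : ∀ a s, (∀ b c, gam b (gam c (φ p)) s = 0) →
      dirDeriv (e a) (fun q => φ q s) p = 0 → spinConn g e 0 a φ p s = 0 := by
    intro a s h h'
    simp [spinConn, Omega, Finset.sum_apply, h, h', -Fintype.sum_sum_type]
  -- No local constancy of the chirality is needed: at each point, differentiating the product
  -- relations forces the derivatives of the vanishing components to be zero, since `φ p ≠ 0`.
  by_cases h : φ p ∅ = 0 ∧ φ p {0, 1} = 0
  · refine Or.inr ⟨h.1, h.2, fun a => ⟨hs a _ (fun b c => (gam_gam_two_odd b c h.1 h.2).1) ?_,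
      hs a _ (fun b c => (gam_gam_two_odd b c h.1 h.2).2) ?_⟩⟩ <;>
    · by_contra hne
      have h₀ : φ p {0} = 0 := by
        have e₁ := d₁ (e a)
        have e₃ := d₃ (e a)
        simp only [h.1, h.2, zero_mul, add_zero, mul_eq_zero] at e₁ e₃
        tauto
      have h₁ : φ p {1} = 0 := by
        have e₂ := d₂ (e a)
        have e₄ := d₄ (e a)
        simp only [h.1, h.2, zero_mul, add_zero, mul_eq_zero] at e₂ e₄
        tauto
      exact (hφ.2 p hp).1 (spinor_two_ext h.1 h₀ h₁ h.2)
  · have h₀ : φ p {0} = 0 := by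
      simp only [mul_eq_zero] at m₁ m₃
      tauto
    have h₁ : φ p {1} = 0 := by
      simp only [mul_eq_zero] at m₂ m₄
      tauto
    refine Or.inl ⟨h₀, h₁, fun a => ⟨hs a _ (fun b c => (gam_gam_two_even b c h₀ h₁).1) ?_,
      hs a _ (fun b c => (gam_gam_two_even b c h₀ h₁).2) ?_⟩⟩
    · have e₁ := d₁ (e a)
      have e₃ := d₃ (e a)
      simp only [h₀, zero_mul, zero_add, mul_eq_zero] at e₁ e₃
      tauto
    · have e₂ := d₂ (e a)
      have e₄ := d₄ (e a)
      simp only [h₁, zero_mul, zero_add, mul_eq_zero] at e₂ e₄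
      tauto

/-- In dimension `4`, a pure spinor field that generates an integrable distribution is a twistor
with respect to some `1`-form. -/
theorem IsIntegrableOn.exists_isTwistorOn (h : IsIntegrableOn e φ U) (hU : IsOpen U)
    (he : g.IsNullFrameOn e U) (hφ : IsPureFieldOn φ U) :
    ∃ A : Idx 2 → M → ℂ, IsFormOn A U ∧ IsTwistorOn g e A φ U := by
  obtain ⟨ψ, hψ, hψφ⟩ := exists_dual_spinor hφ.1 fun p hp => (hφ.2 p hp).1
  refine ⟨fun a q => formSolution (φ q) (ψ q) (fun b => spinConn g e 0 b φ q) a,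
    contMDiffOn_formSolution (contMDiffOn_component hφ.1) hψ
      fun a s => he.contMDiffOn_spinConn hU hφ.1 (fun _ => contMDiffOn_const) a s,
    fun a p hp => twistorOp_eq_zero (χ := twistorSolution (φ p) (ψ p)
      (fun b => spinConn g e 0 b φ p)) (fun b => ?_) a⟩
  rw [spinConn_eq_add]
  exact formSolution_spec (hψφ p hp) (spinConn_parity_two hU hφ hp)
    (fun x hx y hy => h.clif_sum_spinConn hU he hφ 0 hp hx hy) b

end FourDim

/-! ### Constant metrics and constant fields -/

section Flat

open Bundle

/-- A bilinear form on a vector space, as a bilinear form on its tangent spaces. -/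
noncomputable def tangentForm {F : Type*} [NormedAddCommGroup F] [NormedSpace ℝ F]
    (B : F →L[ℝ] F →L[ℝ] ℝ) (p : F) :
    TangentSpace 𝓘(ℝ, F) p →L[ℝ] TangentSpace 𝓘(ℝ, F) p →L[ℝ] ℝ := B

theorem linearMapAt_dual {F : Type*} [NormedAddCommGroup F] [NormedSpace ℝ F] (x p : F)
    (l : TangentSpace 𝓘(ℝ, F) p →L[ℝ] ℝ) (w : F) :
    Trivialization.linearMapAt ℝ (trivializationAt (F →L[ℝ] ℝ)
      (fun p => TangentSpace 𝓘(ℝ, F) p →L[ℝ] ℝ) x) p l w = l w := by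
  rw [Trivialization.linearMapAt_apply, if_pos (by simp [chartAt_self_eq])]
  change ContinuousLinearMap.inCoordinates F (TangentSpace 𝓘(ℝ, F)) ℝ
    (Bundle.Trivial F ℝ) x p x p l w = l w
  simp [ContinuousLinearMap.inCoordinates]
  rfl

/-- Over a vector space the trivializations of the tangent bundle and of its dual act as the
identity, so a constant form has constant coordinates. -/
theorem contMDiff_tangentForm {F : Type*} [NormedAddCommGroup F] [NormedSpace ℝ F]
    (B : F →L[ℝ] F →L[ℝ] ℝ) :
    ContMDiff 𝓘(ℝ, F) (𝓘(ℝ, F).prod 𝓘(ℝ, F →L[ℝ] F →L[ℝ] ℝ)) ∞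
      (fun p => TotalSpace.mk' (F →L[ℝ] F →L[ℝ] ℝ)
        (E := fun p : F => TangentSpace 𝓘(ℝ, F) p →L[ℝ] TangentSpace 𝓘(ℝ, F) p →L[ℝ] ℝ) p
        (tangentForm B p)) := by
  intro x
  rw [contMDiffAt_section]
  refine (contMDiffAt_const (c := B)).congr_of_eventuallyEq
    (Filter.Eventually.of_forall fun p => ?_)
  change ContinuousLinearMap.inCoordinates F (TangentSpace 𝓘(ℝ, F)) (F →L[ℝ] ℝ)
    (fun p => TangentSpace 𝓘(ℝ, F) p →L[ℝ] ℝ) x p x p (tangentForm B p) = B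
  ext v w
  refine (linearMapAt_dual x p _ w).trans ?_
  simp only [TangentBundle.symmL_model_space]
  rfl

variable {n : ℕ}

/-- The diagonal bilinear form with coefficients `ε`. -/
noncomputable def diagForm {N : ℕ} (ε : Fin N → ℝ) :
    EuclideanSpace ℝ (Fin N) →L[ℝ] EuclideanSpace ℝ (Fin N) →L[ℝ] ℝ :=
  ∑ k, (EuclideanSpace.proj k : EuclideanSpace ℝ (Fin N) →L[ℝ] ℝ).smulRight
    (ε k • (EuclideanSpace.proj k : EuclideanSpace ℝ (Fin N) →L[ℝ] ℝ))

theorem diagForm_apply {N : ℕ} (ε : Fin N → ℝ) (v w : EuclideanSpace ℝ (Fin N)) :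
    diagForm ε v w = ∑ k, ε k * (v k * w k) := by
  simp only [diagForm, sum_apply]
  refine Finset.sum_congr rfl fun k _ => ?_
  simp
  ring

theorem diagForm_single {N : ℕ} (ε : Fin N → ℝ) (v : EuclideanSpace ℝ (Fin N)) (k : Fin N) :
    diagForm ε v (EuclideanSpace.single k 1) = ε k * v k := by
  simp [diagForm_apply]

/-- The constant metric with coefficients `ε` on `ℝ^{2n}`. -/
noncomputable def flatMetric (ε : Fin (2 * n) → ℝ) (hε : ∀ k, ε k ≠ 0) :
    Metric n (EuclideanSpace ℝ (Fin (2 * n))) where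
  inner p := tangentForm (diagForm ε) p
  symm p v w := by
    refine (diagForm_apply ε v w).trans (Eq.trans ?_ (diagForm_apply ε w v).symm)
    exact Finset.sum_congr rfl fun k _ => by ring
  nondegenerate p v hv := by
    refine PiLp.ext fun k => ?_
    exact (mul_eq_zero.1 ((diagForm_single ε v k).symm.trans (hv _))).resolve_left (hε k)
  contMDiff := contMDiff_tangentForm (diagForm ε)

theorem flatMetric_inner (ε : Fin (2 * n) → ℝ) (hε : ∀ k, ε k ≠ 0)
    (p v w : EuclideanSpace ℝ (Fin (2 * n))) :
    (flatMetric ε hε).inner p v w = ∑ k, ε k * (v k * w k) := diagForm_apply ε v w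

theorem flatMetric_hasSignature {r s : ℕ} (τ : Fin (2 * n) ≃ Fin r ⊕ Fin s)
    (hε : ∀ k, Sum.elim (fun _ => (1 : ℝ)) (fun _ => -1) (τ k) ≠ 0) :
    (flatMetric (fun k => Sum.elim (fun _ => (1 : ℝ)) (fun _ => -1) (τ k)) hε).HasSignature
      r s := by
  intro p
  refine ⟨(EuclideanSpace.basisFun (Fin (2 * n)) ℝ).toBasis.reindex τ, fun i j => ?_⟩
  have h : ∀ i j, diagForm (fun k => Sum.elim (fun _ => (1 : ℝ)) (fun _ => -1) (τ k))
      ((EuclideanSpace.basisFun (Fin (2 * n)) ℝ).toBasis.reindex τ i)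
      ((EuclideanSpace.basisFun (Fin (2 * n)) ℝ).toBasis.reindex τ j) =
        if i = j then Sum.elim (fun _ => (1 : ℝ)) (fun _ => -1) i else 0 := fun i j => by
    rw [diagForm_apply]
    rcases eq_or_ne i j with rfl | hij
    · simp
    · simp [hij, hij.symm]
  exact h i j

/-- A constant vector field. -/
def constVec (v : EuclideanSpace ℝ (Fin (2 * n))) (p : EuclideanSpace ℝ (Fin (2 * n))) :
    TangentSpace (𝓡 (2 * n)) p := v

/-- The constant complex vector field with components `m`. -/
noncomputable def constField (m : Fin (2 * n) → ℂ) : CField n (EuclideanSpace ℝ (Fin (2 * n))) :=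
  fun p => (constVec (WithLp.toLp 2 fun k => (m k).re) p,
    constVec (WithLp.toLp 2 fun k => (m k).im) p)

theorem contMDiff_constField (v : EuclideanSpace ℝ (Fin (2 * n))) :
    ContMDiffOn (𝓡 (2 * n)) (𝓡 (2 * n)).tangent ∞
      (fun p => (⟨p, constVec v p⟩ : TangentBundle (𝓡 (2 * n)) (EuclideanSpace ℝ (Fin (2 * n)))))
        Set.univ :=
  contMDiffOn_vectorSpace_iff_contDiffOn.2 contDiffOn_const

theorem smoothFieldOn_constField (m : Fin (2 * n) → ℂ) :
    SmoothFieldOn (constField m) Set.univ :=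
  ⟨contMDiff_constField _, contMDiff_constField _⟩

theorem mlieBracket_constVec (v w : EuclideanSpace ℝ (Fin (2 * n))) (p) :
    VectorField.mlieBracket (𝓡 (2 * n)) (constVec v) (constVec w) p = 0 := by
  rw [← VectorField.mlieBracketWithin_univ, VectorField.mlieBracketWithin_eq_lieBracketWithin]
  have h : ∀ u : EuclideanSpace ℝ (Fin (2 * n)),
      fderivWithin ℝ (constVec u : EuclideanSpace ℝ (Fin (2 * n)) → EuclideanSpace ℝ (Fin (2 * n)))
        Set.univ p = 0 :=
    fun u => (hasFDerivWithinAt_const u p _).fderivWithin uniqueDiffWithinAt_univ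
  simp only [VectorField.lieBracketWithin]
  refine (congrArg₂ _ (congrFun (congrArg _ (h w)) _) (congrFun (congrArg _ (h v)) _)).trans ?_
  exact sub_zero _

theorem bracket_constField (m m' : Fin (2 * n) → ℂ) :
    bracket (constField m) (constField m') = 0 := by
  funext p
  have h := fun v w : EuclideanSpace ℝ (Fin (2 * n)) => mlieBracket_constVec v w p
  simp only [bracket, constField, h]
  simp

variable (ε : Fin (2 * n) → ℝ) (hε : ∀ k, ε k ≠ 0)

theorem pair_constField (m m' : Fin (2 * n) → ℂ) (p) :
    (flatMetric ε hε).pair (constField m) (constField m') p = ∑ k, ε k * (m k * m' k) := by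
  have h : ∀ f f' : Fin (2 * n) → ℝ, 
      (flatMetric ε hε).inner p (constVec (WithLp.toLp 2 f) p) (constVec (WithLp.toLp 2 f') p)
        = ∑ k, ε k * (f k * f' k) := fun f f' => flatMetric_inner ε hε p _ _
  simp only [Metric.pair, constField, h]
  apply Complex.ext <;>
    simp [mul_sub, mul_add, Finset.sum_sub_distrib, Finset.sum_add_distrib]

theorem leviCivita_constField (m m' m'' : Fin (2 * n) → ℂ) (p) :
    (flatMetric ε hε).leviCivita (constField m) (constField m') (constField m'') p = 0 := by
  have h₁ : ∀ m m', (flatMetric ε hε).pair (constField m) (constField m')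
      = fun _ => ∑ k, ε k * (m k * m' k) := fun m m' => funext fun p => pair_constField ε hε m m' p
  have h₂ : ∀ m, (flatMetric ε hε).pair (0 : CField n _) (constField m) p = 0 := fun m => by
    simp [Metric.pair]
  simp only [Metric.leviCivita, bracket_constField, h₁, h₂, dirDeriv_const]
  simp

end Flat

/-! ### Null frames and dual coordinates in every signature -/

section FlatFrame

variable {n : ℕ}

/-- The complex linear function with coefficients `l`. -/
noncomputable def linearFun (l : Fin (2 * n) → ℂ) :
    EuclideanSpace ℝ (Fin (2 * n)) →L[ℝ] ℂ :=
  ∑ k, (EuclideanSpace.proj k : EuclideanSpace ℝ (Fin (2 * n)) →L[ℝ] ℝ).smulRight (l k)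

theorem linearFun_apply (l : Fin (2 * n) → ℂ) (p : EuclideanSpace ℝ (Fin (2 * n))) :
    linearFun l p = ∑ k, (p k : ℂ) * l k := by
  simp [linearFun]

theorem dirDeriv_linearFun (l m : Fin (2 * n) → ℂ) (p : EuclideanSpace ℝ (Fin (2 * n))) :
    dirDeriv (constField m) (linearFun l) p = ∑ k, l k * m k := by
  have h : ∀ v, mder (n := n) (linearFun l) p v = linearFun l v := fun v =>
    congrFun (congrArg DFunLike.coe ((mfderiv_eq_fderiv (f := linearFun l) (x := p)).trans
      (linearFun l).fderiv)) v
  have h' : ∀ f : Fin (2 * n) → ℝ, linearFun l (constVec (WithLp.toLp 2 f) p)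
      = ∑ k, (f k : ℂ) * l k := fun f => linearFun_apply l _
  rw [dirDeriv_eq, h, h]
  simp only [constField, h', Finset.mul_sum, ← Finset.sum_add_distrib]
  refine Finset.sum_congr rfl fun k _ => ?_
  conv_rhs => rw [← Complex.re_add_im (m k)]
  ring

/-- The components of the vectors of a null frame in an orthonormal one. -/
noncomputable def nullMat : Matrix (Idx n) (Idx n) ℂ :=
  Matrix.fromBlocks ((1 / 2 : ℂ) • 1) ((Complex.I / 2) • 1) ((1 / 2 : ℂ) • 1) (-(Complex.I / 2) • 1)

/-- The rows are `(x + iy)/2` and `(x - iy)/2` for orthonormal pairs `x, y`; the transpose, not the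
adjoint, appears because the inner product is complex bilinear. -/
theorem nullMat_mul_transpose : (nullMat : Matrix (Idx n) (Idx n) ℂ) * nullMat.transpose = eta := by
  have h : Complex.I / 2 * (Complex.I / 2) = -(1 / 4) := by
    rw [div_mul_div_comm, Complex.I_mul_I]; norm_num
  simp only [nullMat, eta, Matrix.fromBlocks_transpose, Matrix.fromBlocks_multiply,
    Matrix.transpose_smul, Matrix.transpose_one, smul_mul_smul_comm, mul_one, ← add_smul, mul_neg,
    neg_mul, h]
  norm_num

/-- In every signature there are a flat metric, a null frame of constant vector fields and the
corresponding complex coordinates. -/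
theorem exists_flat_metric {r s : ℕ} (hrs : r + s = 2 * n) :
    ∃ (g : Metric n (EuclideanSpace ℝ (Fin (2 * n))))
      (e : Idx n → CField n (EuclideanSpace ℝ (Fin (2 * n))))
      (z : Idx n → EuclideanSpace ℝ (Fin (2 * n)) → ℂ),
      g.HasSignature r s ∧ g.IsNullFrameOn e Set.univ ∧
        (∀ a b c p, g.leviCivita (e a) (e b) (e c) p = 0) ∧
        (∀ a, ContMDiffOn (𝓡 (2 * n)) 𝓘(ℝ, ℂ) ∞ (z a) Set.univ) ∧ (∀ a, z a 0 = 0) ∧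
        ∀ a b p, dirDeriv (e a) (z b) p = if a = b then 1 else 0 := by
  let τ : Fin (2 * n) ≃ Fin r ⊕ Fin s := (finCongr hrs.symm).trans finSumFinEquiv.symm
  let σ : Fin (2 * n) ≃ Idx n := (finCongr (two_mul n)).trans finSumFinEquiv.symm
  let ε : Fin (2 * n) → ℝ := fun k => Sum.elim (fun _ => (1 : ℝ)) (fun _ => -1) (τ k)
  -- Multiplying the negative directions by `i` makes every complexified basis vector have square
  -- `1`, so one matrix serves all signatures.
  let c : Fin (2 * n) → ℂ := fun k => Sum.elim (fun _ => (1 : ℂ)) (fun _ => Complex.I) (τ k)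
  have hc : ∀ k, (ε k : ℂ) * (c k * c k) = 1 := fun k => by
    simp only [ε, c]
    rcases τ k with i | i <;> simp
  have hε : ∀ k, ε k ≠ 0 := fun k h => by simpa [h] using hc k
  let m : Idx n → Fin (2 * n) → ℂ := fun a k => c k * nullMat a (σ k)
  have hm : ∀ a b, ∑ k, (ε k : ℂ) * (m a k * m b k) = eta a b := fun a b => by
    rw [← nullMat_mul_transpose, Matrix.mul_apply, ← σ.sum_comp]
    refine Finset.sum_congr rfl fun k _ => ?_
    rw [Matrix.transpose_apply, ← one_mul (nullMat a (σ k) * _), ← hc k]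
    ring
  refine ⟨flatMetric ε hε, fun a => constField (m a),
    -- The coordinate `z_a` has the dual covector `g^{ad} ⟨e_d, ·⟩` as its differential.
    fun a => linearFun fun k => ∑ d, etaInv a d * (ε k * m d k), flatMetric_hasSignature τ hε,
    ⟨fun a => smoothFieldOn_constField _, fun p _ a b => ?_⟩,
    fun a b d p => leviCivita_constField ε hε _ _ _ p,
    fun a => (linearFun _).contDiff.contMDiff.contMDiffOn, fun a => map_zero _, fun a b p => ?_⟩
  · rw [pair_constField, hm]
  · rw [dirDeriv_linearFun]
    simp only [Finset.sum_mul]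
    rw [Finset.sum_comm]
    have h : ∀ d, ∑ k, etaInv b d * (ε k * m d k) * m a k = etaInv b d * eta d a := fun d => by
      rw [← hm, Finset.mul_sum]
      exact Finset.sum_congr rfl fun k _ => by ring
    simp only [h, sum_etaInv_mul_eta, eq_comm]

end FlatFrame

/-! ### The counterexamples -/

section Examples

variable {n : ℕ}

/-- The spinor `1` of `⋀ V*`. -/
noncomputable def vac : Spinor n := Pi.single ∅ 1

theorem vac_empty : (vac : Spinor n) ∅ = 1 := by simp [vac]

theorem vac_ne_zero : (vac : Spinor n) ≠ 0 := fun h => by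
  simpa [vac] using congrFun h ∅

theorem contract_vac (i : Fin n) : contract i (vac : Spinor n) = 0 := by
  funext s
  simp [contract_apply, vac]

theorem wedge_apply_empty (i : Fin n) (φ : Spinor n) : wedge i φ ∅ = 0 := by
  simp [wedge_apply]

theorem contract_wedge (i j : Fin n) (φ : Spinor n) :
    contract i (wedge j φ) = (if i = j then (1 : ℂ) else 0) • φ - wedge j (contract i φ) :=
  eq_sub_of_add_eq (contract_wedge_add i j φ)

theorem wedge_swap (i j : Fin n) (φ : Spinor n) : wedge i (wedge j φ) = -wedge j (wedge i φ) :=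
  eq_neg_of_add_eq_zero_left (wedge_wedge_add i j φ)

theorem wedge_self (i : Fin n) (φ : Spinor n) : wedge i (wedge i φ) = 0 :=
  self_eq_neg.1 (wedge_swap i i φ)

/-- `1 + a θ^i ∧ θ^j + b θ^i ∧ θ^k + c θ^j ∧ θ^k` is pure. -/
theorem isPure_bivector {i j k : Fin n} (hij : i ≠ j) (hik : i ≠ k) (hjk : j ≠ k) (a b c : ℂ) :
    IsPure (vac + (a • wedge i (wedge j vac) + b • wedge i (wedge k vac)
      + c • wedge j (wedge k vac)) : Spinor n) := by
  -- With only three indices the bivector `B` satisfies `B ∧ B = 0`, so the spinor is `exp B` and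
  -- its annihilator is the graph of the vectors `e_l - e_l ⌟ B`.
  refine isPure_of_graph (fun h => ?_) fun l => ?_
  · simpa [wedge_apply_empty, vac_empty] using congrFun h ∅
  have e₁ := fun ψ : Spinor n => wedge_swap j i ψ
  have e₂ := fun ψ : Spinor n => wedge_swap k i ψ
  have e₃ := fun ψ : Spinor n => wedge_swap k j ψ
  by_cases hi : l = i
  · subst hi
    refine ⟨Pi.single (Sum.inl l) 1 - a • Pi.single (Sum.inr j) 1 - b • Pi.single (Sum.inr k) 1,
      ?_, fun m => by simp [Pi.single_apply, eq_comm]⟩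
    simp only [map_sub, map_smul, LinearMap.sub_apply, LinearMap.smul_apply, clif_single, gam,
      Sum.elim_inl, Sum.elim_inr, map_add, contract_wedge, contract_vac, wedge_self, e₁, e₂, e₃,
      hij, hik, if_true, if_false, map_neg, map_zero, smul_zero]
    module
  by_cases hj : l = j
  · subst hj
    refine ⟨Pi.single (Sum.inl l) 1 + a • Pi.single (Sum.inr i) 1 - c • Pi.single (Sum.inr k) 1,
      ?_, fun m => by simp [Pi.single_apply, eq_comm]⟩
    simp only [map_sub, map_add, map_smul, LinearMap.sub_apply, LinearMap.add_apply,
      LinearMap.smul_apply, clif_single, gam,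
      Sum.elim_inl, Sum.elim_inr, contract_wedge, contract_vac, wedge_self, e₂, e₃,
      hij.symm, hjk, if_true, if_false, map_neg, map_zero, smul_zero]
    module
  by_cases hk : l = k
  · subst hk
    refine ⟨Pi.single (Sum.inl l) 1 + b • Pi.single (Sum.inr i) 1 + c • Pi.single (Sum.inr j) 1,
      ?_, fun m => by simp [Pi.single_apply, eq_comm]⟩
    simp only [map_add, map_sub, map_smul, LinearMap.add_apply,
      LinearMap.smul_apply, clif_single, gam,
      Sum.elim_inl, Sum.elim_inr, contract_wedge, contract_vac, wedge_self, e₁,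
      hik.symm, hjk.symm, if_true, if_false, map_zero, smul_zero]
    module
  · refine ⟨Pi.single (Sum.inl l) 1, ?_, fun m => by simp [Pi.single_apply, eq_comm]⟩
    simp [clif_single, gam, contract_wedge, contract_vac, hi, hj, hk]

variable {M : Type*} [TopologicalSpace M] [ChartedSpace (EuclideanSpace ℝ (Fin (2 * n))) M]

/-- The spinor field `ψ₀ + ∑ a, z_a ψ_a`. -/
noncomputable def affineSpinor (z : Idx n → M → ℂ) (ψ₀ : Spinor n) (ψ : Idx n → Spinor n) (p : M) :
    Spinor n := ψ₀ + ∑ a, z a p • ψ a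

variable {z : Idx n → M → ℂ} {ψ₀ : Spinor n} {ψ : Idx n → Spinor n}

theorem contMDiffOn_affineSpinor
    (hz : ∀ a, ContMDiffOn (𝓡 (2 * n)) 𝓘(ℝ, ℂ) ∞ (z a) Set.univ) :
    ContMDiffOn (𝓡 (2 * n)) 𝓘(ℝ, Spinor n) ∞ (affineSpinor z ψ₀ ψ) Set.univ := by
  let L : (Idx n → ℂ) →L[ℝ] Spinor n :=
    ((Fintype.linearCombination ℂ ψ).restrictScalars ℝ).toContinuousLinearMap
  have h : ContDiff ℝ ∞ fun v : Idx n → ℂ => ψ₀ + L v := contDiff_const.add L.contDiff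
  have h' : ContMDiffOn (𝓡 (2 * n)) 𝓘(ℝ, Idx n → ℂ) ∞ (fun p a => z a p) Set.univ :=
    contMDiffOn_pi_space.2 hz
  refine (h.contMDiff.comp_contMDiffOn h').congr fun p _ => ?_
  simp [affineSpinor, L, Fintype.linearCombination_apply]

variable [IsManifold (𝓡 (2 * n)) ∞ M] {g : Metric n M} {e : Idx n → CField n M}

/-- `Ω_a` vanishes in a frame with zero connection coefficients, and the `z_b` are dual to the
frame; hence the derivatives of `φ` can be prescribed as arbitrary constants. -/
theorem spinConn_affineSpinor (hg : ∀ a b c p, g.leviCivita (e a) (e b) (e c) p = 0)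
    (hz : ∀ a, ContMDiffOn (𝓡 (2 * n)) 𝓘(ℝ, ℂ) ∞ (z a) Set.univ)
    (hez : ∀ a b p, dirDeriv (e a) (z b) p = if a = b then 1 else 0) (a : Idx n) (p : M) :
    spinConn g e 0 a (affineSpinor z ψ₀ ψ) p = ψ a := by
  have h : Omega g e 0 a p = 0 := by simp [Omega, omegaUp, hg]
  rw [spinConn, h, LinearMap.zero_apply, add_zero]
  funext s
  have hd := fun b => mdifferentiableAt_of_contMDiffOn (hz b) isOpen_univ (Set.mem_univ p)
  have hs := dirDeriv_sum (X := e a) (f := fun b q => z b q * ψ b s) Finset.univ fun b =>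
    (hd b).mul (mdifferentiableAt_const (c := ψ b s))
  have h₁ : (fun q => affineSpinor z ψ₀ ψ q s) = fun q => ψ₀ s + ∑ b, z b q * ψ b s := by
    funext q
    simp [affineSpinor]
  rw [h₁, dirDeriv_add mdifferentiableAt_const hs.1, dirDeriv_const, zero_add]
  refine hs.2.trans ?_
  have h₂ : ∀ b, dirDeriv (e a) (fun q => z b q * ψ b s) p = (if a = b then 1 else 0) * ψ b s := by
    intro b
    rw [dirDeriv_mul (hd b) mdifferentiableAt_const, dirDeriv_const, hez]
    ring
  refine (Finset.sum_congr rfl fun b _ => h₂ b).trans ?_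
  simp

/-- In dimension at least `6`, an integrable pure spinor that is not a twistor. -/
theorem exists_isIntegrableOn_not_isTwistorOn (hn : 3 ≤ n) {r s : ℕ} (hrs : r + s = 2 * n) :
    ∃ (g : Metric n (EuclideanSpace ℝ (Fin (2 * n))))
      (e : Idx n → CField n (EuclideanSpace ℝ (Fin (2 * n))))
      (φ : EuclideanSpace ℝ (Fin (2 * n)) → Spinor n),
      g.HasSignature r s ∧ g.IsNullFrameOn e Set.univ ∧ IsPureFieldOn φ Set.univ ∧
        IsIntegrableOn e φ Set.univ ∧
        ∀ A : Idx n → EuclideanSpace ℝ (Fin (2 * n)) → ℂ,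
          IsFormOn A Set.univ → ¬ IsTwistorOn g e A φ Set.univ := by
  obtain ⟨g, e, z, hg, he, hge, hz, -, hez⟩ := exists_flat_metric hrs
  let i : Fin n := ⟨0, by omega⟩
  let j : Fin n := ⟨1, by omega⟩
  let k : Fin n := ⟨2, by omega⟩
  have hij : i ≠ j := by simp [i, j]
  have hik : i ≠ k := by simp [i, k]
  have hjk : j ≠ k := by simp [j, k]
  let ξ : Spinor n := wedge i (wedge j vac)
  have hφ : ∀ p, affineSpinor z vac (Pi.single (Sum.inr k) ξ) p = vac + z (Sum.inr k) p • ξ :=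
    fun p => by
      rw [affineSpinor, Finset.sum_eq_single (Sum.inr k), Pi.single_eq_same]
      · intro b _ hb
        rw [Pi.single_eq_of_ne hb, smul_zero]
      · simp
  have hsm := contMDiffOn_affineSpinor (ψ₀ := vac) (ψ := Pi.single (Sum.inr k) ξ) hz
  have hconn := spinConn_affineSpinor (ψ₀ := vac) (ψ := Pi.single (Sum.inr k) ξ) hge hz hez
  have hpure : ∀ p, IsPure (affineSpinor z vac (Pi.single (Sum.inr k) ξ) p) := fun p => by
    have h := isPure_bivector hij hik hjk (z (Sum.inr k) p) 0 0
    rwa [zero_smul, zero_smul, add_zero, add_zero, ← hφ p] at h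
  refine ⟨g, e, affineSpinor z vac (Pi.single (Sum.inr k) ξ), hg, he,
    ⟨hsm, fun p _ => hpure p⟩, he.isIntegrableOn isOpen_univ hsm 0 fun p _ x _ y hy => ?_,
    fun A _ hA => ?_⟩
  -- The field `e_k` lies in `N_φ`, which is isotropic, so vectors of `N_φ` have no `θ^k` component.
  -- That is the only direction in which `φ` varies, so `∇_y φ = 0` for `y ∈ N_φ`.
  · have hk : Pi.single (Sum.inl k) (1 : ℂ) ∈
        annihilator (affineSpinor z vac (Pi.single (Sum.inr k) ξ) p) := by
      rw [mem_annihilator, clif_single, hφ]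
      simp [ξ, gam, contract_wedge, contract_vac, hik.symm, hjk.symm]
    have hyk := inn_eq_zero_of_mem_annihilator (hpure p).1 hy hk
    have hyk' : y (Sum.inr k) = 0 := by
      simpa [inn_apply, eta, Pi.single_apply, Matrix.one_apply] using hyk
    have hsum : ∑ b, y b •
        spinConn g e 0 b (affineSpinor z vac (Pi.single (Sum.inr k) ξ)) p = 0 := by
      refine Finset.sum_eq_zero fun b _ => ?_
      rw [hconn]
      rcases eq_or_ne b (Sum.inr k) with rfl | hb
      · rw [hyk', zero_smul]
      · rw [Pi.single_eq_of_ne hb, smul_zero]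
    rw [hsum, map_zero]
  · have h := hA (Sum.inr k) 0 (Set.mem_univ _)
    rw [twistorOp, spinConn_eq_add, hconn, Pi.single_eq_same, hφ] at h
    -- An exterior product with `θ^k` has no scalar part, whereas `φ` has scalar part `1`; this
    -- excludes a form `A`. Multiplying again by `θ^k` would then give `θ^k ∧ θ^i ∧ θ^j = 0`.
    have h₀ : A (Sum.inr k) 0 = 0 := by
      simpa [ξ, gam, wedge_apply_empty, vac_empty] using congrFun h ∅
    have h₁ : wedge k ξ = 0 := by
      simpa [h₀, gam, wedge_self] using congrArg (wedge k) h
    have h₂ := congrArg (fun ψ => contract j (contract i (contract k ψ))) h₁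
    simp [ξ, contract_wedge, contract_vac, hik.symm, hjk.symm, hij, vac_ne_zero] at h₂

/-- In dimension `6`, a pure twistor that is not integrable. -/
theorem exists_isTwistorOn_not_isIntegrableOn {r s : ℕ} (hrs : r + s = 2 * 3) :
    ∃ (g : Metric 3 (EuclideanSpace ℝ (Fin (2 * 3))))
      (e : Idx 3 → CField 3 (EuclideanSpace ℝ (Fin (2 * 3))))
      (φ : EuclideanSpace ℝ (Fin (2 * 3)) → Spinor 3)
      (A : Idx 3 → EuclideanSpace ℝ (Fin (2 * 3)) → ℂ),
      g.HasSignature r s ∧ g.IsNullFrameOn e Set.univ ∧ IsPureFieldOn φ Set.univ ∧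
        IsFormOn A Set.univ ∧ IsTwistorOn g e A φ Set.univ ∧ ¬ IsIntegrableOn e φ Set.univ := by
  obtain ⟨g, e, z, hg, he, hge, hz, hz₀, hez⟩ := exists_flat_metric hrs
  let χ : Spinor 3 := wedge 0 (wedge 1 (wedge 2 vac))
  have hsm := contMDiffOn_affineSpinor (ψ₀ := vac) (ψ := fun a => gam a χ) hz
  have hconn := spinConn_affineSpinor (ψ₀ := vac) (ψ := fun a => gam a χ) hge hz hez
  have hpure : ∀ p, IsPure (affineSpinor z vac (fun a => gam a χ) p) := fun p => by
    -- The top form `χ` is killed by every `θ^a`, so only the products `e_a · χ` remain, and their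
    -- coefficients carry the signs of the contractions.
    have h := isPure_bivector (n := 3) (i := 0) (j := 1) (k := 2) (by decide) (by decide)
      (by decide) (z (Sum.inl 2) p) (-z (Sum.inl 1) p) (z (Sum.inl 0) p)
    convert h using 1
    have e₁ := fun ψ : Spinor 3 => wedge_swap 1 0 ψ
    have e₂ := fun ψ : Spinor 3 => wedge_swap 2 0 ψ
    have e₃ := fun ψ : Spinor 3 => wedge_swap 2 1 ψ
    simp [affineSpinor, χ, gam, Fin.sum_univ_three, contract_wedge, contract_vac, wedge_self,
      e₁, e₂, e₃]
    module
  refine ⟨g, e, affineSpinor z vac (fun a => gam a χ), 0, hg, he, ⟨hsm, fun p _ => hpure p⟩,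
    fun a => contMDiffOn_const, fun a p _ => twistorOp_eq_zero (fun b => hconn b p) a, fun h => ?_⟩
  -- At the origin `N_φ` is spanned by the `e_i`, and symmetry of `x · ∇_y φ` would read `e_0 · e_1
  -- · χ = e_1 · e_0 · χ`. The two sides are opposite and nonzero.
  have hφ : affineSpinor z vac (fun a => gam a χ) 0 = vac := by simp [affineSpinor, hz₀]
  have hmem : ∀ i, Pi.single (Sum.inl i) (1 : ℂ) ∈
      annihilator (affineSpinor z vac (fun a => gam a χ) 0) := fun i => by
    rw [hφ, mem_annihilator, clif_single]
    exact contract_vac i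
  have hs : ∀ i : Fin 3, ∑ b, (Pi.single (Sum.inl i) (1 : ℂ) : Idx 3 → ℂ) b •
      spinConn g e 0 b (affineSpinor z vac fun a => gam a χ) 0 = contract i χ := fun i => by
    rw [Finset.sum_eq_single (Sum.inl i), Pi.single_eq_same, one_smul, hconn]
    · rfl
    · intro b _ hb
      rw [Pi.single_eq_of_ne hb, zero_smul]
    · simp
  have h' := h.clif_sum_spinConn isOpen_univ he ⟨hsm, fun p _ => hpure p⟩ 0 (Set.mem_univ 0)
    (hmem 0) (hmem 1)
  rw [hs, hs, clif_single, clif_single] at h'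
  have h₂ := congrArg (contract 2) h'
  simp [χ, gam, contract_wedge, contract_vac] at h₂
  exact vac_ne_zero (neg_eq_self.1 h₂)

end Examples

end PureTwistor

theorem mainTheorem7 :
    -- dimension 4
    (∀ (M : Type*) [TopologicalSpace M] [ChartedSpace (EuclideanSpace ℝ (Fin (2 * 2))) M]
        [IsManifold (𝓡 (2 * 2)) ∞ M] (g : PureTwistor.Metric 2 M) (U : Set M)
        (e : Idx 2 → CField 2 M) (φ : M → Spinor 2),
        IsOpen U → g.IsNullFrameOn e U → IsPureFieldOn φ U →
        (∀ A : Idx 2 → M → ℂ, IsFormOn A U → IsTwistorOn g e A φ U → IsIntegrableOn e φ U) ∧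
        (IsIntegrableOn e φ U → ∃ A : Idx 2 → M → ℂ, IsFormOn A U ∧ IsTwistorOn g e A φ U)) ∧
    -- dimension 6
    (∀ r s : ℕ, r + s = 2 * 3 →
        (∃ (g : PureTwistor.Metric 3 (EuclideanSpace ℝ (Fin (2 * 3))))
            (e : Idx 3 → CField 3 (EuclideanSpace ℝ (Fin (2 * 3))))
            (φ : EuclideanSpace ℝ (Fin (2 * 3)) → Spinor 3)
            (A : Idx 3 → EuclideanSpace ℝ (Fin (2 * 3)) → ℂ),
          g.HasSignature r s ∧ g.IsNullFrameOn e Set.univ ∧ IsPureFieldOn φ Set.univ ∧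
            IsFormOn A Set.univ ∧ IsTwistorOn g e A φ Set.univ ∧
            ¬ IsIntegrableOn e φ Set.univ) ∧
        (∃ (g : PureTwistor.Metric 3 (EuclideanSpace ℝ (Fin (2 * 3))))
            (e : Idx 3 → CField 3 (EuclideanSpace ℝ (Fin (2 * 3))))
            (φ : EuclideanSpace ℝ (Fin (2 * 3)) → Spinor 3),
          g.HasSignature r s ∧ g.IsNullFrameOn e Set.univ ∧ IsPureFieldOn φ Set.univ ∧
            IsIntegrableOn e φ Set.univ ∧
            ∀ A : Idx 3 → EuclideanSpace ℝ (Fin (2 * 3)) → ℂ,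
              IsFormOn A Set.univ → ¬ IsTwistorOn g e A φ Set.univ)) ∧
    -- dimension 8 and higher
    (∀ n : ℕ, 4 ≤ n →
      (∀ (M : Type*) [TopologicalSpace M] [ChartedSpace (EuclideanSpace ℝ (Fin (2 * n))) M]
          [IsManifold (𝓡 (2 * n)) ∞ M] (g : PureTwistor.Metric n M) (U : Set M)
          (e : Idx n → CField n M) (φ : M → Spinor n) (A : Idx n → M → ℂ),
          IsOpen U → g.IsNullFrameOn e U → IsPureFieldOn φ U → IsFormOn A U →
          IsTwistorOn g e A φ U → IsIntegrableOn e φ U) ∧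
      (∀ r s : ℕ, r + s = 2 * n →
        ∃ (g : PureTwistor.Metric n (EuclideanSpace ℝ (Fin (2 * n))))
            (e : Idx n → CField n (EuclideanSpace ℝ (Fin (2 * n))))
            (φ : EuclideanSpace ℝ (Fin (2 * n)) → Spinor n),
          g.HasSignature r s ∧ g.IsNullFrameOn e Set.univ ∧ IsPureFieldOn φ Set.univ ∧
            IsIntegrableOn e φ Set.univ ∧
            ∀ A : Idx n → EuclideanSpace ℝ (Fin (2 * n)) → ℂ,
              IsFormOn A Set.univ → ¬ IsTwistorOn g e A φ Set.univ)) := by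
  refine ⟨fun M _ _ _ g U e φ hU he hφ =>
    ⟨fun A _ h => h.isIntegrableOn (Or.inl rfl) hU he hφ, fun h => h.exists_isTwistorOn hU he hφ⟩,
    fun r s hrs => ⟨exists_isTwistorOn_not_isIntegrableOn hrs,
      exists_isIntegrableOn_not_isTwistorOn le_rfl hrs⟩,
    fun n hn => ⟨fun M _ _ _ g U e φ A hU he hφ _ h => h.isIntegrableOn (Or.inr hn) hU he hφ,
      fun r s hrs => exists_isIntegrableOn_not_isTwistorOn (by omega) hrs⟩⟩
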